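/- Let $n\ge 0$ be an integer, and let $\mathbb{D}^2$ be the closed unit disk in $\mathbb{R}^2$. A polycylinder is a subset of $\mathbb{R}^{n+2}$ that is congruent to $\mathbb{D}^2\times\mathbb{R}^n$, that is, its image under an isometry of $\mathbb{R}^{n+2}$. A polycylinder packing is a countable family $\mathscr{C}=\{C_i\}_{i\in I}$ of polycylinders in $\mathbb{R}^{n+2}$ with mutually disjoint interiors, and its upper density is \[ \delta^+(\mathscr{C})=\limsup_{r\to\infty}\frac{\operatorname{Vol}\bigl(\bigcup_{i\in I}C_i\cap r\mathbb{B}\bigr)}{\operatorname{Vol}(r\mathbb{B})}, \] where $r\mathbb{B}$ is the open ball of radius $r$ about the origin of $\mathbb{R}^{n+2}$. The upper packing density $\delta^+(\mathbb{D}^2\times\mathbb{R}^n)$ is the supremum of $\delta^+(\mathscr{C})$ over all polycylinder packings $\mathscr{C}$ of $\mathbb{R}^{n+2}$. Then $\delta^+(\mathscr{C})\le\pi/\sqrt{12}$ for every polycylinder packing $\mathscr{C}$ of $\mathbb{R}^{n+2}$; that is, $\delta^+(\mathbb{D}^2\times\mathbb{R}^n)\le\pi/\sqrt{12}$. The bound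 is sharp: let $\Lambda\subset\mathbb{R}^2$ be the lattice generated by $(2,0)$ and $(1,\sqrt3)$. Then the product $\{(c+\mathbb{D}^2)\times\mathbb{R}^n\}_{c\in\Lambda}$ of the hexagonal disk packing with $\mathbb{R}^n$ is a polycylinder packing of $\mathbb{R}^{n+2}$ of upper density exactly $\pi/\sqrt{12}$. -/

import Mathlib

/-- Two subsets of `ℝ^d` are congruent if an isometry of `ℝ^d` onto itself carries one to the
other. -/
def IsCongruentTo {d : ℕ} (S K : Set (EuclideanSpace ℝ (Fin d))) : Prop :=
  ∃ φ : EuclideanSpace ℝ (Fin d) ≃ᵢ EuclideanSpace ℝ (Fin d), S = φ '' K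

/-- `C` is a packing of `ℝ^d` by copies of `K`: a countable family of sets congruent to `K`
whose interiors are mutually disjoint. -/
structure IsPackingBy {d : ℕ} (K : Set (EuclideanSpace ℝ (Fin d))) {ι : Type*}
    (C : ι → Set (EuclideanSpace ℝ (Fin d))) : Prop where
  countable : Countable ι
  congruent : ∀ i, IsCongruentTo (C i) K
  disjoint_interiors : Pairwise fun i j => Disjoint (interior (C i)) (interior (C j))

/-- Upper density of a family of sets of `ℝ^d`: the limit superior, as `r → ∞`, of the proportion
of the open ball of radius `r` about the origin that is covered by the family. -/
noncomputable def upperDensity {d : ℕ} {ι : Type*}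
    (C : ι → Set (EuclideanSpace ℝ (Fin d))) : ENNReal :=
  Filter.limsup
    (fun r : ℝ =>
      MeasureTheory.volume ((⋃ i, C i) ∩ Metric.ball (0 : EuclideanSpace ℝ (Fin d)) r) /
        MeasureTheory.volume (Metric.ball (0 : EuclideanSpace ℝ (Fin d)) r))
    Filter.atTop

/-- Upper packing density of `K`: the supremum of the upper densities of all packings by copies
of `K`. As packings are countable, index types in `Type` suffice. -/
noncomputable def upperPackingDensity {d : ℕ} (K : Set (EuclideanSpace ℝ (Fin d))) : ENNReal :=
  sSup {δ | ∃ (ι : Type) (C : ι → Set (EuclideanSpace ℝ (Fin d))),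
    IsPackingBy K C ∧ δ = upperDensity C}

/-- The product `S × ℝ^n` in `ℝ^(n+2)` of a set `S` in the plane (the first two coordinates). -/
def prodSpace (n : ℕ) (S : Set (EuclideanSpace ℝ (Fin 2))) :
    Set (EuclideanSpace ℝ (Fin (n + 2))) :=
  {x | !₂[x 0, x 1] ∈ S}

/-- The standard polycylinder `𝔻² × ℝ^n`, where `𝔻²` is the closed unit disk. -/
def stdPolycylinder (n : ℕ) : Set (EuclideanSpace ℝ (Fin (n + 2))) :=
  prodSpace n (Metric.closedBall 0 1)

/-- The hexagonal packing of the plane by unit disks: the centers form the lattice generated by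
`(2, 0)` and `(1, √3)`. -/
noncomputable def hexDisk (p : ℤ × ℤ) : Set (EuclideanSpace ℝ (Fin 2)) :=
  Metric.closedBall !₂[2 * (p.1 : ℝ) + (p.2 : ℝ), √3 * (p.2 : ℝ)] 1

/-- The product of the hexagonal disk packing with `ℝ^n`. -/
noncomputable def hexPolycylinder (n : ℕ) (p : ℤ × ℤ) : Set (EuclideanSpace ℝ (Fin (n + 2))) :=
  prodSpace n (hexDisk p)

/-!
The proof follows A. Thue for disks and A. Bezdek and W. Kuperberg for circular cylinders.

The interiors of the polycylinders are disjoint exactly when their cores (affine subspaces of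
codimension two) have mutual distances at least `2`; see `separatedCores_of_disjoint_interiors`. To
each core belongs its Dirichlet cell, truncated at the distance `ρ = 2 / √3` from the core. The
truncated cells are disjoint, so the density bound follows by Fubini (`volume_inter_ball_le`) once
every slice of a truncated cell by a plane orthogonal to its core has area at least `√12`, the
area of the regular hexagon circumscribed about the unit disk; this is `le_volume_slice`.

The slice is the disk of radius `ρ` minus the cuts made by the other cores. A point at distance `ρ`
from the given core cannot be closer to each of two further cores, because three points of a ball
of radius `ρ` with mutual distances at least `2` form an equilateral triangle inscribed in a great
circle (`no_three_separated`). Hence the sectors over the arcs cut off by different cores are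
disjoint, and it is enough to show that each cut has at most the share `1 - 3 √3 / (2 π)` of its own
sector: the rest of the disk then has area at least `(3 √3 / (2 π)) (4 π / 3) = √12`.

Two `n`-dimensional cores in `ℝ^(n+2)` that stay apart have a common perpendicular. Therefore their
position involves a single angle, and the boundary of the cut is a parabola in every dimension
(`exists_normal_form`). If the cut subtends the angle `2 α`, its area is the area
`ρ ^ 2 (α - sin α cos α)` of a circular segment minus that of the cap of the parabola over the chord
(`integral_cutWidth`). For `α ≤ π / 6` the segment alone is small enough, by concavity of the
sine. For larger `α` a wide cut forces a large cap (`cap_aperture`), and the estimate reduces to the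
inequality `le_sin_sub_sin_two_mul`, again a matter of concavity, as `α ≤ π / 4`.

For the hexagonal packing, the rectangles with sides `2` and `√3` about the centers of the disks
cover the plane, and the same use of Fubini gives the reverse inequality.
-/

open Real MeasureTheory Set

/-! ### Trigonometric inequalities -/

/-- The circumradius `2 / √3` of an equilateral triangle of side `2`. -/
noncomputable def cutRadius : ℝ := 2 / √3

lemma cutRadius_pos : 0 < cutRadius := by unfold cutRadius; positivity

lemma cutRadius_sq : cutRadius ^ 2 = 4 / 3 := by
  unfold cutRadius; rw [div_pow, sq_sqrt (by norm_num)]; norm_num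

lemma cutRadius_eq : cutRadius = 2 * √3 / 3 := by
  have h : √3 * √3 = 3 := mul_self_sqrt (by norm_num)
  unfold cutRadius
  rw [div_eq_div_iff (by positivity) (by norm_num)]
  linarith

lemma cutRadius_lt : cutRadius < 7 / 6 := by
  have := cutRadius_sq
  nlinarith [cutRadius_pos]

lemma le_sin_two_mul_of_le_pi_div_six {α : ℝ} (h0 : 0 ≤ α) (h1 : α ≤ π / 6) :
    3 * √3 / π * α ≤ sin (2 * α) := by
  have hc := strictConcaveOn_sin_Icc.concaveOn
  have hs := @hc.2 0 ⟨le_rfl, pi_pos.le⟩ (π / 3) ⟨by positivity, by linarith [pi_pos]⟩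
    (1 - 6 * α / π) (6 * α / π)
    (by rw [sub_nonneg, div_le_one pi_pos]; linarith) (by positivity) (by ring)
  simp only [smul_eq_mul, mul_zero, sin_zero, zero_add, sin_pi_div_three] at hs
  have e : 6 * α / π * (π / 3) = 2 * α := by field_simp; ring
  rw [e] at hs
  calc 3 * √3 / π * α = 6 * α / π * (√3 / 2) := by ring
    _ ≤ _ := hs

/-- The inequality for wide cuts, with equality at `π / 6`. -/
lemma le_sin_sub_sin_two_mul {α : ℝ} (h0 : π / 6 ≤ α) (h1 : α ≤ π / 4) :
    2 * √3 / π * α ≤ 8 * √3 / 9 * sin α - 2 / 9 * sin (2 * α) := by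
  have hpi := pi_pos
  have d1 : ∀ x : ℝ, HasDerivAt (fun x => 8 * √3 / 9 * sin x - 2 / 9 * sin (2 * x))
      (8 * √3 / 9 * cos x - 4 / 9 * cos (2 * x)) x := by
    intro x
    have := ((hasDerivAt_sin x).const_mul (8 * √3 / 9)).sub
      ((((hasDerivAt_id' x).const_mul 2).sin).const_mul (2 / 9))
    exact this.congr_deriv (by ring)
  have d2 : ∀ x : ℝ, HasDerivAt (fun x => 8 * √3 / 9 * cos x - 4 / 9 * cos (2 * x))
      (- (8 * √3 / 9) * sin x + 8 / 9 * sin (2 * x)) x := by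
    intro x
    have := ((hasDerivAt_cos x).const_mul (8 * √3 / 9)).sub
      ((((hasDerivAt_id' x).const_mul 2).cos).const_mul (4 / 9))
    exact this.congr_deriv (by ring)
  have hc : ConcaveOn ℝ (Icc (π / 6) (π / 4))
      (fun x => 8 * √3 / 9 * sin x - 2 / 9 * sin (2 * x)) := by
    refine concaveOn_of_hasDerivWithinAt2_nonpos (convex_Icc _ _)
      (fun x _ => (d1 x).continuousAt.continuousWithinAt)
      (fun x _ => (d1 x).hasDerivWithinAt) (fun x _ => (d2 x).hasDerivWithinAt) ?_
    intro x hx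
    rw [interior_Icc] at hx
    have hs : 0 ≤ sin x := sin_nonneg_of_nonneg_of_le_pi (by linarith [hx.1]) (by linarith [hx.2])
    have hcos : cos x ≤ √3 / 2 := by
      rw [← cos_pi_div_six]
      exact cos_le_cos_of_nonneg_of_le_pi (by positivity) (by linarith [hx.2]) hx.1.le
    rw [sin_two_mul]
    nlinarith [mul_nonneg hs (sub_nonneg.2 hcos)]
  have hs := @hc.2 (π / 6) ⟨le_rfl, by linarith⟩ (π / 4) ⟨by linarith, le_rfl⟩
    (3 - 12 * α / π) (12 * α / π - 2)
    (by rw [sub_nonneg, div_le_iff₀ hpi]; linarith)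
    (by rw [sub_nonneg, le_div_iff₀ hpi]; linarith) (by ring)
  have e : (3 - 12 * α / π) * (π / 6) + (12 * α / π - 2) * (π / 4) = α := by field_simp; ring
  simp only [smul_eq_mul] at hs
  rw [e, show 2 * (π / 6) = π / 3 by ring, show 2 * (π / 4) = π / 2 by ring, sin_pi_div_six,
    sin_pi_div_three, sin_pi_div_two, sin_pi_div_four] at hs
  refine le_trans ?_ hs
  have hb : 0 ≤ 12 * α / π - 2 := by rw [sub_nonneg, le_div_iff₀ hpi]; linarith
  -- the value at `π / 4` exceeds the linear bound `√3 / 2`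
  have key : √3 / 2 ≤ 8 * √3 / 9 * (√2 / 2) - 2 / 9 * 1 := by
    have e2 : 1.4142 ≤ √2 := by apply le_sqrt_of_sq_le; norm_num
    have e3 : 1.732 ≤ √3 := by apply le_sqrt_of_sq_le; norm_num
    nlinarith [mul_le_mul_of_nonneg_left e2 (by positivity : (0:ℝ) ≤ √3)]
  have e4 : 2 * √3 / π * α = (3 - 12 * α / π) * (√3 / 3) + (12 * α / π - 2) * (√3 / 2) := by
    field_simp; ring
  rw [e4]
  nlinarith [mul_le_mul_of_nonneg_left key hb]

/-! ### Parabolas that cut a disk -/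

/-- Lower bound for the aperture of the parabola: if `(k C ∓ σ S, k S ± σ C)` are the points at
which the parabola meets the circle, `σ C` is half of the width of the parabolic cap.  A tilt
(`C < 1`) only enlarges the cap. -/
lemma cap_aperture {t c m k σ C S : ℝ} (ht : 2 ≤ t) (hc : c ^ 2 ≤ 1) (hσ : 0 < σ) (hC : 0 < C)
    (hCS : C ^ 2 + S ^ 2 = 1)
    (h1 : (t - (k * C - σ * S)) ^ 2 + (c * (k * S + σ * C) - m) ^ 2 = k ^ 2 + σ ^ 2)
    (h2 : (t - (k * C + σ * S)) ^ 2 + (c * (k * S - σ * C) - m) ^ 2 = k ^ 2 + σ ^ 2) :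
    t * (2 - 2 * k) ≤ (1 - c ^ 2) * σ ^ 2 * C ^ 3 := by
  have e1 : c * (c * k * S - m) * C = - S * (t - k * C) := by
    have : σ * (c * (c * k * S - m) * C + S * (t - k * C)) = 0 := by linarith
    rcases mul_eq_zero.1 this with h | h
    · exact absurd h hσ.ne'
    · linarith
  have e2 : (1 - c ^ 2) * σ ^ 2 * C ^ 2 = (t - k * C) ^ 2 + (c * k * S - m) ^ 2 - k ^ 2 := by
    have : S ^ 2 = 1 - C ^ 2 := by linarith
    have hh : σ ^ 2 * S ^ 2 = σ ^ 2 * (1 - C ^ 2) := by rw [this]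
    linarith
  have e3 : S ^ 2 * (t - k * C) ^ 2 ≤ (c * k * S - m) ^ 2 * C ^ 2 := by
    have : S ^ 2 * (t - k * C) ^ 2 = c ^ 2 * ((c * k * S - m) ^ 2 * C ^ 2) := by
      linear_combination (S * (t - k * C) - c * (c * k * S - m) * C) * e1
    rw [this]
    exact mul_le_of_le_one_left (by positivity) hc
  have hC1 : C ≤ 1 := by nlinarith [sq_nonneg S]
  have e4 : t * (t - 2 * k * C) ≤ (1 - c ^ 2) * σ ^ 2 * C ^ 2 * C ^ 2 := by
    rw [e2]
    have : S ^ 2 * (t - k * C) ^ 2 = (1 - C ^ 2) * (t - k * C) ^ 2 := by rw [← hCS]; ring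
    nlinarith
  have e5 : t * (2 - 2 * k) * C ≤ (1 - c ^ 2) * σ ^ 2 * C ^ 3 * C := by
    nlinarith [mul_nonneg (by linarith : 0 ≤ t) (by linarith : 0 ≤ t - 2 * C)]
  exact le_of_mul_le_mul_right e5 hC

/-- Abscissa, at height `y`, of the parabola bounding the points of the plane that are at least as
close to the second core as to the origin. -/
noncomputable def parabola (t c m y : ℝ) : ℝ := (t ^ 2 - y ^ 2 + (c * y - m) ^ 2) / (2 * t)

lemma parabola_le_iff {t c m x y : ℝ} (ht : 0 < t) :
    parabola t c m y ≤ x ↔ (t - x) ^ 2 + (c * y - m) ^ 2 ≤ x ^ 2 + y ^ 2 := by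
  unfold parabola
  rw [div_le_iff₀ (by positivity)]
  constructor <;> intro h <;> linarith

lemma parabola_lt_iff {t c m x y : ℝ} (ht : 0 < t) :
    parabola t c m y < x ↔ (t - x) ^ 2 + (c * y - m) ^ 2 < x ^ 2 + y ^ 2 := by
  unfold parabola
  rw [div_lt_iff₀ (by positivity)]
  constructor <;> intro h <;> linarith

/-- Width, at height `y`, of the region between the parabola and the circle. -/
noncomputable def cutWidth (t c m y : ℝ) : ℝ := √(4 / 3 - y ^ 2) - parabola t c m y

lemma continuous_cutWidth (t c m : ℝ) : Continuous (cutWidth t c m) := by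
  unfold cutWidth parabola; fun_prop

lemma cutWidth_neg_of_sq_eq {t c m y : ℝ} (ht : 2 ≤ t) (hy : y ^ 2 = 4 / 3) :
    cutWidth t c m y < 0 := by
  unfold cutWidth parabola
  rw [hy, sub_self, sqrt_zero, zero_sub, neg_lt_zero]
  apply div_pos _ (by linarith)
  nlinarith [sq_nonneg (c * y - m)]

/-- The circle is more curved than the parabola. -/
lemma concaveOn_cutWidth {t c m : ℝ} (ht : 2 ≤ t) (hc : c ^ 2 ≤ 1) :
    ConcaveOn ℝ (Icc (-cutRadius) cutRadius) (cutWidth t c m) := by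
  have hsq := cutRadius_sq
  have h0 : ConcaveOn ℝ (Icc (-cutRadius) cutRadius) (fun y : ℝ => 4 / 3 - y ^ 2) := by
    refine ⟨convex_Icc _ _, fun x _ y _ a b ha hb hab => ?_⟩
    simp only [smul_eq_mul]
    have : b = 1 - a := by linarith
    subst this
    nlinarith [mul_nonneg (mul_nonneg ha hb) (sq_nonneg (x - y))]
  have him : ∀ y ∈ Icc (-cutRadius) cutRadius, 0 ≤ 4 / 3 - y ^ 2 := by
    intro y hy
    nlinarith [hy.1, hy.2]
  have h1 : ConcaveOn ℝ (Icc (-cutRadius) cutRadius) (fun y : ℝ => √(4 / 3 - y ^ 2)) := by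
    refine ⟨convex_Icc _ _, fun x hx y hy a b ha hb hab => ?_⟩
    have h2 := strictConcaveOn_sqrt.concaveOn.2 (him x hx) (him y hy) ha hb hab
    exact h2.trans (sqrt_le_sqrt (h0.2 hx hy ha hb hab))
  set κ : ℝ := (1 - c ^ 2) / (2 * t) with hκ
  have hκ4 : κ ≤ 1 / 4 := by
    rw [hκ, div_le_iff₀ (by linarith)]
    nlinarith [sq_nonneg c]
  -- on the disk `cutWidth` is an affine function plus `z - κ z ^ 2` with `z = √(4 / 3 - y ^ 2)`
  have hrw : ∀ y ∈ Icc (-cutRadius) cutRadius, cutWidth t c m y =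
      √(4 / 3 - y ^ 2) - κ * √(4 / 3 - y ^ 2) ^ 2 +
        (κ * (4 / 3) - (t ^ 2 + m ^ 2 - 2 * c * m * y) / (2 * t)) := by
    intro y hy
    rw [sq_sqrt (him y hy), cutWidth, parabola, hκ]
    field_simp
    ring
  refine ⟨convex_Icc _ _, fun x hx y hy a b ha hb hab => ?_⟩
  have hxy := (convex_Icc (-cutRadius) cutRadius) hx hy ha hb hab
  have h2 := h1.2 hx hy ha hb hab
  rw [hrw x hx, hrw y hy, hrw _ hxy]
  simp only [smul_eq_mul] at h2 ⊢
  set u := √(4 / 3 - x ^ 2)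
  set v := √(4 / 3 - y ^ 2)
  set w := √(4 / 3 - (a * x + b * y) ^ 2) with hw
  have hlin : a * (κ * (4 / 3) - (t ^ 2 + m ^ 2 - 2 * c * m * x) / (2 * t)) +
      b * (κ * (4 / 3) - (t ^ 2 + m ^ 2 - 2 * c * m * y) / (2 * t)) =
      κ * (4 / 3) - (t ^ 2 + m ^ 2 - 2 * c * m * (a * x + b * y)) / (2 * t) := by
    have : b = 1 - a := by linarith
    subst this
    ring
  have hu : 0 ≤ u := sqrt_nonneg _
  have hv : 0 ≤ v := sqrt_nonneg _
  have hw1 : w ≤ 2 := by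
    rw [hw]; apply sqrt_le_iff.2; constructor
    · norm_num
    · nlinarith [sq_nonneg (a * x + b * y)]
  have hz0 : 0 ≤ a * u + b * v := by positivity
  have hκ0 : 0 ≤ κ := div_nonneg (by linarith) (by linarith)
  have hsqle : (a * u + b * v) ^ 2 ≤ a * u ^ 2 + b * v ^ 2 := by
    have : b = 1 - a := by linarith
    subst this
    nlinarith [mul_nonneg (mul_nonneg ha hb) (sq_nonneg (u - v))]
  have hmono : (a * u + b * v) - κ * (a * u + b * v) ^ 2 ≤ w - κ * w ^ 2 := by
    have : κ * (w + (a * u + b * v)) ≤ 1 := by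
      calc κ * (w + (a * u + b * v)) ≤ 1 / 4 * 4 := by
            apply mul_le_mul hκ4 (by linarith)
              (by linarith [sqrt_nonneg (4 / 3 - (a * x + b * y) ^ 2)]) (by norm_num)
        _ = 1 := by norm_num
    nlinarith [mul_nonneg (sub_nonneg.2 h2) (sub_nonneg.2 this)]
  nlinarith [mul_le_mul_of_nonneg_left hsqle hκ0]

/-- The part of the disk beyond the parabola is bounded by a single arc of the circle. -/
lemma cutWidth_zeros {t c m x : ℝ} (ht : 2 ≤ t) (hc : c ^ 2 ≤ 1)
    (hx : x ∈ Icc (-cutRadius) cutRadius) (hpos : 0 < cutWidth t c m x) :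
    ∃ q p, -cutRadius < q ∧ q < p ∧ p < cutRadius ∧ cutWidth t c m q = 0 ∧ cutWidth t c m p = 0 ∧
      (∀ y ∈ Ioo q p, 0 < cutWidth t c m y) ∧
      ∀ y ∈ Icc (-cutRadius) cutRadius, y ∉ Ioc q p → cutWidth t c m y ≤ 0 := by
  have hcont := continuous_cutWidth t c m
  have hl : cutWidth t c m (-cutRadius) < 0 :=
    cutWidth_neg_of_sq_eq ht (by rw [neg_sq, cutRadius_sq])
  have hr : cutWidth t c m cutRadius < 0 := cutWidth_neg_of_sq_eq ht cutRadius_sq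
  obtain ⟨q, hq, hq0⟩ := intermediate_value_Icc hx.1 hcont.continuousOn ⟨hl.le, hpos.le⟩
  obtain ⟨p, hp, hp0⟩ := intermediate_value_Icc' hx.2 hcont.continuousOn ⟨hr.le, hpos.le⟩
  have hql : -cutRadius < q := lt_of_le_of_ne hq.1 (by rintro rfl; linarith)
  have hqx : q < x := lt_of_le_of_ne hq.2 (by rintro rfl; linarith)
  have hpr : p < cutRadius := lt_of_le_of_ne hp.2 (by rintro rfl; linarith)
  have hxp : x < p := lt_of_le_of_ne hp.1 (by rintro rfl; linarith)
  have key : ∀ u ∈ Icc (-cutRadius) cutRadius, ∀ v, ∀ w ∈ Icc (-cutRadius) cutRadius,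
      u < v → v < w → (w - v) * cutWidth t c m u + (v - u) * cutWidth t c m w ≤ (w - u) * cutWidth t c m v := by
    intro u hu v w hw huv hvw
    have := (concaveOn_cutWidth (m := m) ht hc).slope_anti_adjacent hu hw huv hvw
    rw [div_le_div_iff₀ (by linarith) (by linarith)] at this
    linarith
  refine ⟨q, p, hql, hqx.trans hxp, hpr, hq0, hp0, ?_, ?_⟩
  · intro y hy
    rcases lt_trichotomy y x with h | h | h
    · have := key q ⟨hql.le, by linarith⟩ y x hx hy.1 h
      rw [hq0] at this
      have h2 : 0 < (y - q) * cutWidth t c m x := mul_pos (by linarith [hy.1]) hpos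
      exact pos_of_mul_pos_right (a := x - q) (by linarith) (by linarith)
    · rwa [h]
    · have := key x hx y p ⟨by linarith, hpr.le⟩ h hy.2
      rw [hp0] at this
      have h2 : 0 < (p - y) * cutWidth t c m x := mul_pos (by linarith [hy.2]) hpos
      exact pos_of_mul_pos_right (a := p - x) (by linarith) (by linarith)
  · intro y hy hyn
    by_contra! hlt
    rcases lt_trichotomy y q with h | h | h
    · have := key y hy q x hx h hqx
      rw [hq0] at this
      nlinarith [mul_pos (sub_pos.2 h) hpos, mul_pos (sub_pos.2 hqx) hlt]
    · rw [h, hq0] at hlt; exact lt_irrefl _ hlt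
    · have h3 : p < y := by
        by_contra! h4
        exact hyn ⟨h, h4⟩
      have := key x hx p y hy hxp h3
      rw [hp0] at this
      nlinarith [mul_pos (sub_pos.2 h3) hpos, mul_pos (sub_pos.2 hxp) hlt]

lemma hasDerivAt_circle_antideriv {y : ℝ} (hy : y ∈ Ioo (-cutRadius) cutRadius) :
    HasDerivAt (fun y => y * √(4 / 3 - y ^ 2) / 2 + 2 / 3 * arcsin (y / cutRadius))
      (√(4 / 3 - y ^ 2)) y := by
  have hρ := cutRadius_pos
  have hsq := cutRadius_sq
  have hpos : 0 < 4 / 3 - y ^ 2 := by nlinarith [hy.1, hy.2]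
  have hs : 0 < √(4 / 3 - y ^ 2) := sqrt_pos.2 hpos
  have h1 : HasDerivAt (fun y : ℝ => 4 / 3 - y ^ 2) (-(2 * y)) y := by
    simpa using ((hasDerivAt_id y).pow 2).const_sub (4 / 3)
  have h2 := h1.sqrt hpos.ne'
  have h3 := ((hasDerivAt_id y).mul h2).div_const 2
  have hne1 : y / cutRadius ≠ -1 := by
    intro h; rw [div_eq_iff hρ.ne'] at h; linarith [hy.1]
  have hne2 : y / cutRadius ≠ 1 := by
    intro h; rw [div_eq_iff hρ.ne'] at h; linarith [hy.2]
  have h4 := ((hasDerivAt_arcsin hne1 hne2).comp y ((hasDerivAt_id y).div_const cutRadius)).const_mul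
    (2 / 3 : ℝ)
  have h5 : √(1 - (y / cutRadius) ^ 2) = √(4 / 3 - y ^ 2) / cutRadius := by
    rw [eq_div_iff hρ.ne', ← sqrt_sq hρ.le, ← sqrt_mul' _ (sq_nonneg _), sqrt_sq hρ.le]
    congr 1
    field_simp
    rw [hsq]
    ring
  refine (h3.add h4).congr_deriv ?_
  rw [h5]
  have h6 := sq_sqrt hpos.le
  simp only [id]
  set s := √(4 / 3 - y ^ 2)
  field_simp
  linarith

/-- Area of the circular segment minus the cap of the parabola over the chord. -/
lemma integral_cutWidth {t c m β₁ β₂ : ℝ} (ht : 0 < t) (h1 : -(π / 2) < β₁) (h12 : β₁ < β₂)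
    (h2 : β₂ < π / 2) (hq : cutWidth t c m (cutRadius * sin β₁) = 0)
    (hp : cutWidth t c m (cutRadius * sin β₂) = 0) :
    ∫ y in (cutRadius * sin β₁)..(cutRadius * sin β₂), cutWidth t c m y =
      2 / 3 * (β₂ - β₁) - 2 / 3 * sin (β₂ - β₁) -
        (1 - c ^ 2) / (12 * t) * (cutRadius * sin β₂ - cutRadius * sin β₁) ^ 3 := by
  have hρ := cutRadius_pos
  have hsq := cutRadius_sq
  have hcircle : ∀ β, -(π / 2) < β → β < π / 2 →
      √(4 / 3 - (cutRadius * sin β) ^ 2) = cutRadius * cos β := by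
    intro β hl hr
    rw [mul_pow, hsq, sin_sq, ← sqrt_sq (mul_nonneg hρ.le (cos_pos_of_mem_Ioo ⟨hl, hr⟩).le),
      mul_pow, hsq]
    congr 1
    ring
  have hc1 := hcircle β₁ h1 (h12.trans h2)
  have hc2 := hcircle β₂ (h1.trans h12) h2
  have hmem : ∀ β, -(π / 2) < β → β < π / 2 → cutRadius * sin β ∈ Ioo (-cutRadius) cutRadius := by
    intro β hl hr
    have e1 : sin β < 1 := by
      rw [← sin_pi_div_two]; exact sin_lt_sin_of_lt_of_le_pi_div_two hl.le le_rfl hr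
    have e2 : -1 < sin β := by
      rw [← sin_pi_div_two, ← sin_neg]; exact sin_lt_sin_of_lt_of_le_pi_div_two le_rfl hr.le hl
    constructor <;> nlinarith
  have hm1 := hmem β₁ h1 (h12.trans h2)
  have hm2 := hmem β₂ (h1.trans h12) h2
  have harc : ∀ β, -(π / 2) < β → β < π / 2 → arcsin (cutRadius * sin β / cutRadius) = β := by
    intro β hl hr
    rw [mul_div_cancel_left₀ _ hρ.ne', arcsin_sin hl.le hr.le]
  have hder : ∀ y ∈ Set.uIcc (cutRadius * sin β₁) (cutRadius * sin β₂),
      HasDerivAt (fun y => (y * √(4 / 3 - y ^ 2) / 2 + 2 / 3 * arcsin (y / cutRadius)) -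
        ((t ^ 2 + m ^ 2) * y - c * m * y ^ 2 - (1 - c ^ 2) / 3 * y ^ 3) / (2 * t))
        (cutWidth t c m y) y := by
    intro y hy
    have hy' : y ∈ Ioo (-cutRadius) cutRadius := (ordConnected_Ioo).uIcc_subset hm1 hm2 hy
    have hpar : HasDerivAt (fun y : ℝ => ((t ^ 2 + m ^ 2) * y - c * m * y ^ 2 -
        (1 - c ^ 2) / 3 * y ^ 3) / (2 * t)) (parabola t c m y) y := by
      have := (((((hasDerivAt_id y).const_mul (t ^ 2 + m ^ 2)).sub
        (((hasDerivAt_id y).pow 2).const_mul (c * m))).sub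
        (((hasDerivAt_id y).pow 3).const_mul ((1 - c ^ 2) / 3))).div_const (2 * t))
      refine this.congr_deriv ?_
      simp only [id, parabola]
      congr 1
      push_cast
      ring
    exact (hasDerivAt_circle_antideriv hy').sub hpar
  rw [intervalIntegral.integral_eq_sub_of_hasDerivAt hder
    ((continuous_cutWidth t c m).intervalIntegrable _ _)]
  rw [harc β₁ h1 (h12.trans h2), harc β₂ (h1.trans h12) h2, hc1, hc2]
  unfold cutWidth at hq hp
  rw [hc1] at hq
  rw [hc2] at hp
  rw [sin_sub]
  set u := cutRadius * sin β₁
  set v := cutRadius * sin β₂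
  -- the trapezoid rule for the parabola has the error `κ (v - u) ^ 3 / 6`
  have htrap : ((t ^ 2 + m ^ 2) * v - c * m * v ^ 2 - (1 - c ^ 2) / 3 * v ^ 3) / (2 * t) -
      ((t ^ 2 + m ^ 2) * u - c * m * u ^ 2 - (1 - c ^ 2) / 3 * u ^ 3) / (2 * t) =
      (v - u) * (parabola t c m u + parabola t c m v) / 2 +
        (1 - c ^ 2) / (12 * t) * (v - u) ^ 3 := by
    unfold parabola
    field_simp
    ring
  have hcross : (v - u) * (cutRadius * cos β₁ + cutRadius * cos β₂) =
      v * (cutRadius * cos β₂) - u * (cutRadius * cos β₁) +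
        4 / 3 * (sin β₂ * cos β₁ - cos β₂ * sin β₁) := by
    simp only [u, v]
    rw [← hsq]; ring
  have hq' : parabola t c m u = cutRadius * cos β₁ := by linarith
  have hp' : parabola t c m v = cutRadius * cos β₂ := by linarith
  rw [hq', hp', hcross] at htrap
  linarith

/-- Among all parabolas the straight chord that touches the unit disk and subtends the angle
`π / 3` cuts off the largest proportion of the sector. -/
lemma integral_cutWidth_le {t c m β₁ β₂ : ℝ} (ht : 2 ≤ t) (hc : c ^ 2 ≤ 1) (h1 : -(π / 2) < β₁)
    (h12 : β₁ < β₂) (h2 : β₂ < π / 2) (hq : cutWidth t c m (cutRadius * sin β₁) = 0)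
    (hp : cutWidth t c m (cutRadius * sin β₂) = 0) :
    ∫ y in (cutRadius * sin β₁)..(cutRadius * sin β₂), cutWidth t c m y ≤
      (1 - 3 * √3 / (2 * π)) * (2 / 3 * (β₂ - β₁)) := by
  have hρ := cutRadius_pos
  have hsq := cutRadius_sq
  rw [integral_cutWidth (by linarith) h1 h12 h2 hq hp]
  have hcircle : ∀ β, -(π / 2) < β → β < π / 2 → cutWidth t c m (cutRadius * sin β) = 0 →
      (t - cutRadius * cos β) ^ 2 + (c * (cutRadius * sin β) - m) ^ 2 = cutRadius ^ 2 := by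
    intro β hl hr h0
    have e : √(4 / 3 - (cutRadius * sin β) ^ 2) = cutRadius * cos β := by
      rw [mul_pow, hsq, sin_sq, ← sqrt_sq (mul_nonneg hρ.le (cos_pos_of_mem_Ioo ⟨hl, hr⟩).le),
        mul_pow, hsq]
      congr 1
      ring
    rw [cutWidth, e, parabola, sub_eq_zero, eq_div_iff (by linarith)] at h0
    have := sin_sq_add_cos_sq β
    linear_combination (-1) * h0 + cutRadius ^ 2 * this
  have hc1 := hcircle β₁ h1 (h12.trans h2) hq
  have hc2 := hcircle β₂ (h1.trans h12) h2 hp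
  obtain ⟨ψ, α, hβ₁, hβ₂⟩ : ∃ ψ α, β₁ = ψ - α ∧ β₂ = ψ + α :=
    ⟨(β₁ + β₂) / 2, (β₂ - β₁) / 2, by ring, by ring⟩
  have hα : 0 < α := by linarith
  have hCψ : 0 < cos ψ := cos_pos_of_mem_Ioo ⟨by linarith, by linarith⟩
  have hsinα : 0 < sin α := sin_pos_of_pos_of_lt_pi hα (by linarith)
  have hσ : 0 < cutRadius * sin α := mul_pos hρ hsinα
  have hdiff : cutRadius * sin β₂ - cutRadius * sin β₁ = 2 * (cutRadius * sin α) * cos ψ := by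
    rw [hβ₁, hβ₂, sin_add, sin_sub]; ring
  have hang : β₂ - β₁ = 2 * α := by linarith
  rw [hdiff, hang]
  rcases le_total α (π / 6) with h6 | h6
  · have := le_sin_two_mul_of_le_pi_div_six hα.le h6
    have hcap : 0 ≤ (1 - c ^ 2) / (12 * t) * (2 * (cutRadius * sin α) * cos ψ) ^ 3 :=
      mul_nonneg (div_nonneg (by linarith) (by linarith)) (by positivity)
    have e : 3 * √3 / (2 * π) * (2 / 3 * (2 * α)) = 2 / 3 * (3 * √3 / π * α) := by
      field_simp
    linarith
  · have h4 : α ≤ π / 4 := by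
      -- both end points lie in the sector `cos β ≥ √3 - 1`, inside `|β| ≤ π / 4`
      have hb : ∀ β, -(π / 2) < β → β < π / 2 →
          (t - cutRadius * cos β) ^ 2 + (c * (cutRadius * sin β) - m) ^ 2 = cutRadius ^ 2 →
          |β| ≤ π / 4 := by
        intro β hl hr h0
        have h5 : t - cutRadius * cos β ≤ cutRadius := by
          apply le_of_sq_le_sq _ hρ.le
          nlinarith [sq_nonneg (c * (cutRadius * sin β) - m)]
        by_contra! hlt
        have h6 : cos β < cos (π / 4) := by
          rw [← cos_abs β]
          exact cos_lt_cos_of_nonneg_of_le_pi (by positivity)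
            (by rw [abs_le]; constructor <;> linarith [pi_pos]) hlt
        rw [cos_pi_div_four] at h6
        have h7 : √2 < 1.415 := by rw [sqrt_lt' (by norm_num)]; norm_num
        have h8 := cutRadius_lt
        nlinarith
      have e1 := abs_le.1 (hb β₁ h1 (h12.trans h2) hc1)
      have e2 := abs_le.1 (hb β₂ (h1.trans h12) h2 hc2)
      linarith [e1.1, e2.2]
    have hF := le_sin_sub_sin_two_mul h6 h4
    have hpy : cutRadius ^ 2 = (cutRadius * cos α) ^ 2 + (cutRadius * sin α) ^ 2 := by
      have := sin_sq_add_cos_sq α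
      linear_combination (-cutRadius ^ 2) * this
    have hap : t * (2 - 2 * (cutRadius * cos α)) ≤
        (1 - c ^ 2) * (cutRadius * sin α) ^ 2 * cos ψ ^ 3 := by
      apply cap_aperture (m := m) (S := sin ψ) ht hc hσ hCψ (by rw [cos_sq_add_sin_sq])
      · rw [← hpy, ← hc2, hβ₂, cos_add, sin_add]; ring
      · rw [← hpy, ← hc1, hβ₁, cos_sub, sin_sub]; ring
    have hcap : 2 / 3 * (cutRadius * sin α) * (2 - 2 * (cutRadius * cos α)) ≤
        (1 - c ^ 2) / (12 * t) * (2 * (cutRadius * sin α) * cos ψ) ^ 3 := by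
      have e : (1 - c ^ 2) / (12 * t) * (2 * (cutRadius * sin α) * cos ψ) ^ 3 =
          2 / 3 * (cutRadius * sin α) *
            (((1 - c ^ 2) * (cutRadius * sin α) ^ 2 * cos ψ ^ 3) / t) := by
        field_simp; ring
      rw [e]
      apply mul_le_mul_of_nonneg_left _ (by positivity)
      rw [le_div_iff₀ (by linarith)]
      linarith
    have e1 : 2 / 3 * (cutRadius * sin α) * (2 - 2 * (cutRadius * cos α)) =
        8 * √3 / 9 * sin α - 8 / 9 * sin (2 * α) := by
      rw [sin_two_mul]
      have : 2 / 3 * (cutRadius * sin α) * (2 - 2 * (cutRadius * cos α)) =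
        4 / 3 * cutRadius * sin α - 4 / 3 * cutRadius ^ 2 * (sin α * cos α) := by ring
      rw [this, hsq, cutRadius_eq]; ring
    have e2 : 3 * √3 / (2 * π) * (2 / 3 * (2 * α)) = 2 * √3 / π * α := by
      field_simp
    linarith

/-! ### Areas of cuts and sectors -/

/-- Area of an open circular sector, as a lower bound. -/
lemma ofReal_le_volume_sector {R β₁ β₂ : ℝ} (hR : 0 < R) (h1 : -π ≤ β₁) (h2 : β₂ ≤ π) :
    ENNReal.ofReal (R ^ 2 / 2 * (β₂ - β₁)) ≤
      volume {p : ℝ × ℝ | ∃ r ∈ Ioo (0 : ℝ) 1, ∃ θ ∈ Ioo β₁ β₂,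
        p = (r * (R * cos θ), r * (R * sin θ))} := by
  set A := {p : ℝ × ℝ | ∃ r ∈ Ioo (0 : ℝ) 1, ∃ θ ∈ Ioo β₁ β₂,
        p = (r * (R * cos θ), r * (R * sin θ))} with hA
  calc ENNReal.ofReal (R ^ 2 / 2 * (β₂ - β₁))
      = (∫⁻ r in Ioo 0 R, ENNReal.ofReal r) * volume (Ioo β₁ β₂) := by
        have : ∫⁻ r in Ioo 0 R, ENNReal.ofReal r = ENNReal.ofReal (R ^ 2 / 2) := by
          rw [← ofReal_integral_eq_lintegral_ofReal]
          · rw [← integral_Ioc_eq_integral_Ioo, ← intervalIntegral.integral_of_le hR.le,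
              integral_id]
            congr 1; ring
          · exact (continuous_id.integrableOn_Icc).mono_set Ioo_subset_Icc_self
          · exact (ae_restrict_mem measurableSet_Ioo).mono fun x hx => hx.1.le
        rw [this, Real.volume_Ioo, ENNReal.ofReal_mul (by positivity)]
    _ = ∫⁻ p in Ioo 0 R ×ˢ Ioo β₁ β₂, ENNReal.ofReal p.1 := by
        rw [Measure.volume_eq_prod, ← Measure.prod_restrict, lintegral_prod _ (by fun_prop)]
        simp only [lintegral_const, Measure.restrict_apply_univ]
        rw [lintegral_mul_const _ (by fun_prop)]
    _ = ∫⁻ p in Ioo 0 R ×ˢ Ioo β₁ β₂,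
          ENNReal.ofReal p.1 • A.indicator (fun _ => (1 : ENNReal)) (polarCoord.symm p) := by
        refine setLIntegral_congr_fun (measurableSet_Ioo.prod measurableSet_Ioo) fun p hp => ?_
        have : polarCoord.symm p ∈ A := by
          refine ⟨p.1 / R, ⟨div_pos hp.1.1 hR, (div_lt_one hR).2 hp.1.2⟩, p.2, hp.2, ?_⟩
          rw [polarCoord_symm_apply]
          field_simp
        simp only [indicator_of_mem this, smul_eq_mul, mul_one]
    _ ≤ ∫⁻ p in polarCoord.target,
          ENNReal.ofReal p.1 • A.indicator (fun _ => (1 : ENNReal)) (polarCoord.symm p) := by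
        apply lintegral_mono_set
        rw [polarCoord_target]
        exact prod_mono (fun x hx => hx.1) (Ioo_subset_Ioo h1 h2)
    _ = ∫⁻ p, A.indicator (fun _ => (1 : ENNReal)) p := lintegral_comp_polarCoord_symm _
    _ ≤ volume A := lintegral_indicator_one_le A

/-- The part of the disk of radius `cutRadius` that is at least as close to the second core as to
the origin; the squared distance to the second core is `(t - x) ^ 2 + (c * y - m) ^ 2`. -/
def planeCut (t c m : ℝ) : Set (ℝ × ℝ) :=
  {p | p.1 ^ 2 + p.2 ^ 2 ≤ 4 / 3 ∧ (t - p.1) ^ 2 + (c * p.2 - m) ^ 2 ≤ p.1 ^ 2 + p.2 ^ 2}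

/-- The open sector over the arc of the circle of radius `cutRadius` whose points are closer to the
second core than to the origin. -/
def planeSector (t c m : ℝ) : Set (ℝ × ℝ) :=
  {p | ∃ r ∈ Ioo (0 : ℝ) 1, ∃ x y : ℝ, x ^ 2 + y ^ 2 = 4 / 3 ∧
    (t - x) ^ 2 + (c * y - m) ^ 2 < 4 / 3 ∧ p = (r * x, r * y)}

lemma volume_planeCut_le {t c m : ℝ} (ht : 0 < t) :
    volume (planeCut t c m) ≤
      ∫⁻ y in Icc (-cutRadius) cutRadius, ENNReal.ofReal (cutWidth t c m y) := by
  have hmeas : MeasurableSet (planeCut t c m) := by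
    refine (measurableSet_le (f := fun p : ℝ × ℝ => p.1 ^ 2 + p.2 ^ 2) (g := fun _ => 4 / 3)
      (by fun_prop) (by fun_prop)).inter
      (measurableSet_le (f := fun p : ℝ × ℝ => (t - p.1) ^ 2 + (c * p.2 - m) ^ 2)
        (g := fun p => p.1 ^ 2 + p.2 ^ 2) (by fun_prop) (by fun_prop))
  rw [Measure.volume_eq_prod, Measure.prod_apply_symm hmeas,
    ← lintegral_indicator measurableSet_Icc]
  refine lintegral_mono fun y => ?_
  have hsub : (fun x => (x, y)) ⁻¹' planeCut t c m ⊆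
      Icc (parabola t c m y) (√(4 / 3 - y ^ 2)) := by
    rintro x ⟨h1, h2⟩
    exact ⟨(parabola_le_iff ht).2 h2, le_sqrt_of_sq_le (by simp only at h1; linarith)⟩
  by_cases hy : y ∈ Icc (-cutRadius) cutRadius
  · rw [indicator_of_mem hy]
    exact (measure_mono hsub).trans (by rw [Real.volume_Icc]; rfl)
  · have : (fun x => (x, y)) ⁻¹' planeCut t c m = ∅ := by
      rw [eq_empty_iff_forall_notMem]
      rintro x ⟨h1, -⟩
      apply hy
      have : y ^ 2 ≤ cutRadius ^ 2 := by
        rw [cutRadius_sq]; simp only at h1; nlinarith [sq_nonneg x]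
      exact abs_le.1 (abs_le_of_sq_le_sq this cutRadius_pos.le)
    simp [this]

lemma cutShare_nonneg : 0 ≤ 1 - 3 * √3 / (2 * π) := by
  have h3 : √3 < 2 := by rw [sqrt_lt' (by norm_num)]; norm_num
  rw [sub_nonneg, div_le_one (by positivity)]
  linarith [pi_gt_three]

/-- A cut has at most the share `1 - 3 √3 / (2 π)` of its sector. This is the share attained by
the circular segments of the regular hexagon. -/
theorem volume_planeCut_le_sector {t c m : ℝ} (ht : 2 ≤ t) (hc : c ^ 2 ≤ 1) :
    volume (planeCut t c m) ≤
      ENNReal.ofReal (1 - 3 * √3 / (2 * π)) * volume (planeSector t c m) := by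
  have hρ := cutRadius_pos
  have hsq := cutRadius_sq
  refine (volume_planeCut_le (by linarith)).trans ?_
  by_cases hex : ∃ x ∈ Icc (-cutRadius) cutRadius, 0 < cutWidth t c m x
  swap
  · push Not at hex
    rw [setLIntegral_congr_fun (g := fun _ => 0) measurableSet_Icc
      fun y hy => ENNReal.ofReal_of_nonpos (hex y hy)]
    simp
  obtain ⟨x, hx, hpos⟩ := hex
  obtain ⟨q, p, hq, hqp, hp, hq0, hp0, hin, hout⟩ := cutWidth_zeros ht hc hx hpos
  have hlint : ∫⁻ y in Icc (-cutRadius) cutRadius, ENNReal.ofReal (cutWidth t c m y) ≤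
      ENNReal.ofReal (∫ y in q..p, cutWidth t c m y) := by
    have hnn : ∀ y ∈ Ioc q p, 0 ≤ cutWidth t c m y := by
      intro y hy
      rcases eq_or_lt_of_le hy.2 with h | h
      · rw [h, hp0]
      · exact (hin y ⟨hy.1, h⟩).le
    rw [intervalIntegral.integral_of_le hqp.le, ofReal_integral_eq_lintegral_ofReal
      ((continuous_cutWidth t c m).integrableOn_Ioc)
      ((ae_restrict_mem measurableSet_Ioc).mono hnn), ← lintegral_indicator measurableSet_Icc,
      ← lintegral_indicator measurableSet_Ioc]
    refine lintegral_mono fun y => ?_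
    by_cases h1 : y ∈ Ioc q p
    · rw [indicator_of_mem h1]
      exact indicator_le_self _ _ y
    · rw [indicator_of_notMem h1]
      by_cases h2 : y ∈ Icc (-cutRadius) cutRadius
      · rw [indicator_of_mem h2, ENNReal.ofReal_of_nonpos (hout y h2 h1)]
      · rw [indicator_of_notMem h2]
  have hab : ∀ y, -cutRadius < y → y < cutRadius → -1 < y / cutRadius ∧ y / cutRadius < 1 :=
    fun y h1 h2 => ⟨by rw [lt_div_iff₀ hρ]; linarith, by rw [div_lt_one hρ]; exact h2⟩
  have hq1 := hab q hq (hqp.trans hp)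
  have hp1 := hab p (hq.trans hqp) hp
  have hβ1 : -(π / 2) < arcsin (q / cutRadius) := neg_pi_div_two_lt_arcsin.2 hq1.1
  have hβ2 : arcsin (p / cutRadius) < π / 2 := arcsin_lt_pi_div_two.2 hp1.2
  have hβ : arcsin (q / cutRadius) < arcsin (p / cutRadius) :=
    arcsin_lt_arcsin hq1.1.le (by gcongr) hp1.2.le
  set β₁ := arcsin (q / cutRadius) with hb1
  set β₂ := arcsin (p / cutRadius) with hb2
  have hqs : q = cutRadius * sin β₁ := by
    rw [hb1, sin_arcsin hq1.1.le hq1.2.le]; field_simp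
  have hps : p = cutRadius * sin β₂ := by
    rw [hb2, sin_arcsin hp1.1.le hp1.2.le]; field_simp
  have hint := integral_cutWidth_le (t := t) (c := c) (m := m) ht hc hβ1 hβ hβ2
    (by rw [← hqs]; exact hq0) (by rw [← hps]; exact hp0)
  rw [← hqs, ← hps] at hint
  have h0 := cutShare_nonneg
  calc _ ≤ _ := hlint
    _ ≤ ENNReal.ofReal ((1 - 3 * √3 / (2 * π)) * (2 / 3 * (β₂ - β₁))) :=
        ENNReal.ofReal_le_ofReal hint
    _ = ENNReal.ofReal (1 - 3 * √3 / (2 * π)) *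
          ENNReal.ofReal (cutRadius ^ 2 / 2 * (β₂ - β₁)) := by
        rw [← ENNReal.ofReal_mul h0, hsq]; norm_num
    _ ≤ _ := by
        gcongr
        refine (ofReal_le_volume_sector hρ (by linarith [pi_pos]) (by linarith [pi_pos])).trans
          (measure_mono ?_)
        rintro z ⟨r, hr, θ, hθ, rfl⟩
        have hcos : 0 < cos θ := cos_pos_of_mem_Ioo ⟨by linarith [hθ.1], by linarith [hθ.2]⟩
        have hcirc : (cutRadius * cos θ) ^ 2 + (cutRadius * sin θ) ^ 2 = 4 / 3 := by
          rw [← hsq]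
          linear_combination cutRadius ^ 2 * sin_sq_add_cos_sq θ
        refine ⟨r, hr, _, _, hcirc, ?_, rfl⟩
        have hy : cutRadius * sin θ ∈ Ioo q p := by
          rw [hqs, hps]
          constructor
          · exact mul_lt_mul_of_pos_left
              (sin_lt_sin_of_lt_of_le_pi_div_two hβ1.le (by linarith [hθ.2]) hθ.1) hρ
          · exact mul_lt_mul_of_pos_left
              (sin_lt_sin_of_lt_of_le_pi_div_two (by linarith [hθ.1]) hβ2.le hθ.2) hρ
        have hw := hin _ hy
        have e : √(4 / 3 - (cutRadius * sin θ) ^ 2) = cutRadius * cos θ := by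
          rw [← hcirc, add_sub_cancel_right, sqrt_sq (by positivity)]
        rw [cutWidth, e, sub_pos, parabola_lt_iff (by linarith), hcirc] at hw
        exact hw

/-! ### Polycylinders and their cores -/

/-- The orthogonal splitting `ℝ² × ℝ^n ≃ ℝ^(n+2)`; the plane is spanned by the first two
coordinates. -/
noncomputable def splitIsometry (n : ℕ) :
    WithLp 2 (EuclideanSpace ℝ (Fin 2) × EuclideanSpace ℝ (Fin n)) ≃ₗᵢ[ℝ]
      EuclideanSpace ℝ (Fin (n + 2)) :=
  LinearIsometry.toLinearIsometryEquiv
    { toFun := fun p => WithLp.toLp 2 (Fin.cons (p.fst 0) (Fin.cons (p.fst 1) (fun k => p.snd k)))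
      map_add' := by
        intro p q
        ext k
        refine Fin.cases ?_ (fun k => Fin.cases ?_ (fun k => ?_) k) k <;> simp
      map_smul' := by
        intro c p
        ext k
        refine Fin.cases ?_ (fun k => Fin.cases ?_ (fun k => ?_) k) k <;> simp
      norm_map' := by
        intro p
        rw [← sq_eq_sq₀ (norm_nonneg _) (norm_nonneg _)]
        simp [EuclideanSpace.norm_sq_eq, WithLp.prod_norm_sq_eq_of_L2, Fin.sum_univ_succ, add_assoc] }
    (by
      rw [LinearEquiv.finrank_eq (WithLp.linearEquiv 2 ℝ _)]
      simp [add_comm])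

/-- The point of `ℝ^(n+2)` with planar part `v` and remaining coordinates `ξ`. -/
noncomputable def combine {n : ℕ} (v : EuclideanSpace ℝ (Fin 2)) (ξ : EuclideanSpace ℝ (Fin n)) :
    EuclideanSpace ℝ (Fin (n + 2)) :=
  splitIsometry n (WithLp.toLp 2 (v, ξ))

/-- The planar part of a point, as a linear map. -/
noncomputable def planarPart (n : ℕ) :
    EuclideanSpace ℝ (Fin (n + 2)) →L[ℝ] EuclideanSpace ℝ (Fin 2) :=
  WithLp.fstL 2 ℝ _ _ ∘L (splitIsometry n).symm.toContinuousLinearEquiv.toContinuousLinearMap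

section Polycylinders

variable {n : ℕ}

lemma planarPart_combine (v : EuclideanSpace ℝ (Fin 2)) (ξ : EuclideanSpace ℝ (Fin n)) :
    planarPart n (combine v ξ) = v := by
  simp [planarPart, combine]

lemma exists_combine (y : EuclideanSpace ℝ (Fin (n + 2))) : ∃ ξ, y = combine (planarPart n y) ξ :=
  ⟨((splitIsometry n).symm y).snd, ((splitIsometry n).apply_symm_apply y).symm⟩

lemma combine_add (v v' : EuclideanSpace ℝ (Fin 2)) (ξ ξ' : EuclideanSpace ℝ (Fin n)) :
    combine (v + v') (ξ + ξ') = combine v ξ + combine v' ξ' := by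
  simp only [combine, ← map_add]; rfl

lemma inner_combine (v v' : EuclideanSpace ℝ (Fin 2)) (ξ ξ' : EuclideanSpace ℝ (Fin n)) :
    inner ℝ (combine v ξ) (combine v' ξ') = inner ℝ v v' + inner ℝ ξ ξ' := by
  simp [combine, WithLp.prod_inner_apply]

lemma norm_combine_zero (v : EuclideanSpace ℝ (Fin 2)) :
    ‖combine v (0 : EuclideanSpace ℝ (Fin n))‖ = ‖v‖ := by
  rw [← sq_eq_sq₀ (norm_nonneg _) (norm_nonneg _), ← real_inner_self_eq_norm_sq, inner_combine]
  simp

lemma dist_combine (v v' : EuclideanSpace ℝ (Fin 2)) (ξ : EuclideanSpace ℝ (Fin n)) :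
    dist (combine v ξ) (combine v' ξ) = dist v v' := by
  have h : combine v ξ = combine (v - v') 0 + combine v' ξ := by rw [← combine_add]; simp
  rw [dist_eq_norm, h, add_sub_cancel_right, norm_combine_zero, dist_eq_norm]

lemma inner_combine_zero (v : EuclideanSpace ℝ (Fin 2)) (y : EuclideanSpace ℝ (Fin (n + 2))) :
    inner ℝ (combine v 0) y = inner ℝ v (planarPart n y) := by
  obtain ⟨ξ, hξ⟩ := exists_combine y
  conv_lhs => rw [hξ]
  rw [inner_combine, inner_zero_left, add_zero]

lemma norm_planarPart_le (y : EuclideanSpace ℝ (Fin (n + 2))) : ‖planarPart n y‖ ≤ ‖y‖ := by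
  obtain ⟨ξ, hξ⟩ := exists_combine y
  rw [← sq_le_sq₀ (norm_nonneg _) (norm_nonneg _)]
  conv_rhs => rw [hξ, ← real_inner_self_eq_norm_sq, inner_combine]
  rw [real_inner_self_eq_norm_sq, real_inner_self_eq_norm_sq]
  linarith [sq_nonneg ‖ξ‖]

lemma planarPart_eq (y : EuclideanSpace ℝ (Fin (n + 2))) : planarPart n y = !₂[y 0, y 1] := by
  obtain ⟨ξ, hξ⟩ := exists_combine y
  have h0 : y 0 = planarPart n y 0 := by
    conv_lhs => rw [hξ]
    rfl
  have h1 : y 1 = planarPart n y 1 := by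
    conv_lhs => rw [hξ]
    rfl
  ext k
  fin_cases k
  · exact h0.symm
  · exact h1.symm

lemma continuous_combine :
    Continuous fun p : EuclideanSpace ℝ (Fin 2) × EuclideanSpace ℝ (Fin n) =>
      combine p.1 p.2 := by
  unfold combine
  exact (splitIsometry n).continuous.comp (WithLp.prod_continuous_toLp 2 _ _)

lemma measurePreserving_combine :
    MeasurePreserving fun p : EuclideanSpace ℝ (Fin 2) × EuclideanSpace ℝ (Fin n) =>
      combine p.1 p.2 :=
  (splitIsometry n).measurePreserving.comp (WithLp.volume_preserving_toLp _ _)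

/-- Distance from `y` to the core of the polycylinder `φ (𝔻² × ℝ^n)`. -/
noncomputable def coreDist (φ : EuclideanSpace ℝ (Fin (n + 2)) ≃ᵢ EuclideanSpace ℝ (Fin (n + 2)))
    (y : EuclideanSpace ℝ (Fin (n + 2))) : ℝ :=
  ‖planarPart n (φ.symm y)‖

section Core

variable (φ : EuclideanSpace ℝ (Fin (n + 2)) ≃ᵢ EuclideanSpace ℝ (Fin (n + 2)))

lemma continuous_coreDist : Continuous (coreDist φ) := by
  unfold coreDist
  exact ((planarPart n).continuous.comp φ.symm.continuous).norm

lemma coreDist_le_add_dist (y z : EuclideanSpace ℝ (Fin (n + 2))) :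
    coreDist φ y ≤ coreDist φ z + dist y z := by
  unfold coreDist
  have h := norm_planarPart_le (φ.symm y - φ.symm z)
  rw [map_sub, ← dist_eq_norm (φ.symm y), φ.symm.dist_eq] at h
  linarith [norm_le_norm_add_norm_sub' (planarPart n (φ.symm y)) (planarPart n (φ.symm z))]

lemma coreDist_apply_combine (v : EuclideanSpace ℝ (Fin 2)) (ξ : EuclideanSpace ℝ (Fin n)) :
    coreDist φ (φ (combine v ξ)) = ‖v‖ := by
  rw [coreDist, φ.symm_apply_apply, planarPart_combine]

lemma exists_core_point (y : EuclideanSpace ℝ (Fin (n + 2))) :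
    ∃ p, coreDist φ p = 0 ∧ dist y p = coreDist φ y := by
  obtain ⟨ξ, hξ⟩ := exists_combine (φ.symm y)
  refine ⟨φ (combine 0 ξ), by rw [coreDist_apply_combine, norm_zero], ?_⟩
  rw [← φ.symm.dist_eq, φ.symm_apply_apply]
  conv_lhs => rw [hξ]
  rw [dist_combine, dist_zero_right, coreDist]

end Core

lemma norm_sq_fin_two (z : EuclideanSpace ℝ (Fin 2)) : ‖z‖ ^ 2 = z 0 ^ 2 + z 1 ^ 2 := by
  simp [EuclideanSpace.norm_sq_eq, Fin.sum_univ_two]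

lemma inner_fin_two (z w : EuclideanSpace ℝ (Fin 2)) :
    inner ℝ z w = z 0 * w 0 + z 1 * w 1 := by
  simp [PiLp.inner_apply, Fin.sum_univ_two]; ring

/-- Normal form of the squared distance to a second core on a plane orthogonal to the first one.
Cores that stay at a distance at least `2` have a common perpendicular, so that at most one
principal angle of the two cores, with cosine `|c|`, differs from `0`. -/
lemma exists_normal_form
    (Φ : EuclideanSpace ℝ (Fin (n + 2)) ≃ᵃⁱ[ℝ] EuclideanSpace ℝ (Fin (n + 2)))
    (hΦ : ∀ y, planarPart n y = 0 → 2 ≤ ‖planarPart n (Φ y)‖) (ξ : EuclideanSpace ℝ (Fin n)) :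
    ∃ t c m a₀ a₁ : ℝ, 2 ≤ t ∧ c ^ 2 ≤ 1 ∧ a₀ ^ 2 + a₁ ^ 2 = 1 ∧ ∀ v : EuclideanSpace ℝ (Fin 2),
      ‖planarPart n (Φ (combine v ξ))‖ ^ 2 =
        (t - (a₀ * v 0 + a₁ * v 1)) ^ 2 + (c * (a₀ * v 1 - a₁ * v 0) - m) ^ 2 := by
  set L := Φ.linearIsometryEquiv with hL
  have hadd : ∀ y z, Φ (y + z) = L y + Φ z := fun y z => Φ.map_vadd z y
  set b : EuclideanSpace ℝ (Fin n) → EuclideanSpace ℝ (Fin 2) :=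
    fun η => planarPart n (Φ (combine 0 η)) with hb
  let B : EuclideanSpace ℝ (Fin n) →ₗ[ℝ] EuclideanSpace ℝ (Fin 2) :=
    { toFun := fun η => planarPart n (L (combine 0 η))
      map_add' := by
        intro x y
        have := combine_add (0 : EuclideanSpace ℝ (Fin 2)) 0 x y
        rw [add_zero] at this
        rw [this, map_add, map_add]
      map_smul' := by
        intro r x
        have : combine (0 : EuclideanSpace ℝ (Fin 2)) (r • x) = r • combine 0 x := by
          rw [combine, combine, ← map_smul]
          congr 1
          simp [← WithLp.toLp_smul]
        rw [this, map_smul, map_smul]; rfl }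
  have hbB : ∀ η η', b (η + η') = B η + b η' := by
    intro η η'
    have := combine_add (0 : EuclideanSpace ℝ (Fin 2)) 0 η η'
    rw [add_zero] at this
    simp only [hb, this, hadd, map_add]; rfl
  have hb2 : ∀ η, 2 ≤ ‖b η‖ := fun η => hΦ _ (planarPart_combine _ _)
  -- the point of the affine subspace `b ξ + range B` nearest to the origin
  obtain ⟨w, ⟨η, hη⟩, z, hz, hwz⟩ :=
    (LinearMap.range B).exists_add_mem_mem_orthogonal (b ξ)
  have hzb : z = b (-η + ξ) := by
    rw [hbB, map_neg, hη, hwz]; abel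
  have hz2 : 2 ≤ ‖z‖ := hzb ▸ hb2 _
  have hz0 : 0 < ‖z‖ := by linarith
  set e : EuclideanSpace ℝ (Fin 2) := ‖z‖⁻¹ • z with he
  have hen : ‖e‖ = 1 := by
    rw [he, norm_smul, norm_inv, norm_norm, inv_mul_cancel₀ hz0.ne']
  have heB : ∀ η, inner ℝ e (B η) = 0 := by
    intro η
    rw [he, real_inner_smul_left, real_inner_comm,
      (Submodule.mem_orthogonal _ _).1 hz _ ⟨η, rfl⟩, mul_zero]
  have heb : inner ℝ e (b ξ) = ‖z‖ := by
    rw [hwz, inner_add_right, ← hη, heB, zero_add, he, real_inner_smul_left,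
      real_inner_self_eq_norm_sq]
    field_simp
  have hen2 : e 0 ^ 2 + e 1 ^ 2 = 1 := by rw [← norm_sq_fin_two, hen, one_pow]
  set f : EuclideanSpace ℝ (Fin 2) := !₂[-e 1, e 0] with hf
  have hf0 : f 0 = -e 1 := rfl
  have hf1 : f 1 = e 0 := rfl
  have hfn : ‖f‖ ^ 2 = 1 := by rw [norm_sq_fin_two, hf0, hf1]; linarith
  have hdecomp : ∀ u : EuclideanSpace ℝ (Fin 2),
      ‖u‖ ^ 2 = (inner ℝ e u) ^ 2 + (inner ℝ f u) ^ 2 := by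
    intro u
    rw [norm_sq_fin_two, inner_fin_two, inner_fin_two, hf0, hf1]
    linear_combination (-(u 0 ^ 2 + u 1 ^ 2)) * hen2
  have hadj : ∀ (u : EuclideanSpace ℝ (Fin 2)) (y : EuclideanSpace ℝ (Fin (n + 2))),
      inner ℝ u (planarPart n (L y)) = inner ℝ (L.symm (combine u 0)) y := by
    intro u y
    rw [← inner_combine_zero, ← L.inner_map_map (L.symm _) y, L.apply_symm_apply]
  -- the adjoint maps `e` to a unit vector `x` of the plane orthogonal to the first core
  obtain ⟨x, hX⟩ : ∃ x : EuclideanSpace ℝ (Fin 2),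
      L.symm (combine e 0) = combine x (0 : EuclideanSpace ℝ (Fin n)) := by
    obtain ⟨η, hη⟩ := exists_combine (L.symm (combine e (0 : EuclideanSpace ℝ (Fin n))))
    have h := heB η
    change inner ℝ e (planarPart n (L (combine 0 η))) = 0 at h
    rw [hadj, hη, inner_combine, inner_zero_right, zero_add] at h
    rw [inner_self_eq_zero.1 h] at hη
    exact ⟨_, hη⟩
  have hxn : ‖x‖ ^ 2 = 1 := by
    rw [← norm_combine_zero (n := n), ← hX, L.symm.norm_map, norm_combine_zero, hen, one_pow]
  set y := planarPart n (L.symm (combine f (0 : EuclideanSpace ℝ (Fin n)))) with hy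
  have hyn : ‖y‖ ^ 2 ≤ 1 := by
    have h := norm_planarPart_le (L.symm (combine f (0 : EuclideanSpace ℝ (Fin n))))
    rw [L.symm.norm_map, norm_combine_zero] at h
    rw [← hfn]
    exact pow_le_pow_left₀ (norm_nonneg _) h 2
  have hxy : inner ℝ x y = 0 := by
    rw [hy, ← inner_combine_zero, ← hX, L.symm.inner_map_map, inner_combine, inner_fin_two, hf0,
      hf1, inner_zero_left]
    ring
  have hfv : ∀ v : EuclideanSpace ℝ (Fin 2),
      inner ℝ f (planarPart n (L (combine v 0))) = inner ℝ y v := by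
    intro v
    rw [hadj, real_inner_comm, inner_combine_zero, real_inner_comm]
  rw [norm_sq_fin_two] at hxn hyn
  rw [inner_fin_two] at hxy
  refine ⟨‖z‖, x 1 * y 0 - x 0 * y 1, -inner ℝ f (b ξ), -x 0, -x 1, hz2, ?_, by linarith, ?_⟩
  · have : (x 1 * y 0 - x 0 * y 1) ^ 2 = (x 0 ^ 2 + x 1 ^ 2) * (y 0 ^ 2 + y 1 ^ 2) -
      (x 0 * y 0 + x 1 * y 1) ^ 2 := by ring
    rw [this, hxy, hxn]; linarith
  · intro v
    have hsplit : planarPart n (Φ (combine v ξ)) = planarPart n (L (combine v 0)) + b ξ := by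
      have := combine_add v 0 0 ξ
      rw [add_zero, zero_add] at this
      rw [this, hadd, map_add]
    rw [hsplit, hdecomp, inner_add_right, inner_add_right, heb, hfv, hadj, hX, inner_combine,
      inner_zero_left, inner_fin_two, inner_fin_two]
    have hc : (x 1 * y 0 - x 0 * y 1) * (-x 0 * v 1 - -x 1 * v 0) = y 0 * v 0 + y 1 * v 1 := by
      linear_combination (y 0 * v 0 + y 1 * v 1) * hxn - (x 0 * v 0 + x 1 * v 1) * hxy
    rw [hc]
    ring

/-! ### Slices of truncated Dirichlet cells -/

/-- Three points of a ball of radius `2 / √3`, at least two of them in the open ball, cannot have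
mutual distances at least `2`. -/
lemma no_three_separated {E : Type*} [NormedAddCommGroup E] [InnerProductSpace ℝ E] {y p q r : E}
    (hp : dist y p ≤ cutRadius) (hq : dist y q < cutRadius) (hr : dist y r < cutRadius)
    (hpq : 2 ≤ dist p q) (hpr : 2 ≤ dist p r) (hqr : 2 ≤ dist q r) : False := by
  have hsq := cutRadius_sq
  have h1 : dist y p ^ 2 ≤ 4 / 3 := by
    rw [← hsq]; exact pow_le_pow_left₀ dist_nonneg hp 2
  have h2 : dist y q ^ 2 < 4 / 3 := by
    rw [← hsq]; exact pow_lt_pow_left₀ hq dist_nonneg two_ne_zero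
  have h3 : dist y r ^ 2 < 4 / 3 := by
    rw [← hsq]; exact pow_lt_pow_left₀ hr dist_nonneg two_ne_zero
  have e : dist p q ^ 2 + dist p r ^ 2 + dist q r ^ 2 + ‖(y - p) + (y - q) + (y - r)‖ ^ 2 =
      3 * (dist y p ^ 2 + dist y q ^ 2 + dist y r ^ 2) := by
    have f1 : p - q = (y - q) - (y - p) := by abel
    have f2 : p - r = (y - r) - (y - p) := by abel
    have f3 : q - r = (y - r) - (y - q) := by abel
    simp only [dist_eq_norm]
    rw [f1, f2, f3]
    generalize y - p = a
    generalize y - q = b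
    generalize y - r = c
    rw [norm_sub_sq_real, norm_sub_sq_real, norm_sub_sq_real, norm_add_sq_real, norm_add_sq_real,
      inner_add_left, real_inner_comm a b, real_inner_comm a c, real_inner_comm b c]
    ring
  nlinarith [sq_nonneg ‖(y - p) + (y - q) + (y - r)‖]

/-- The coordinates of a planar vector in the positively oriented orthonormal basis whose first
vector is `(a₀, a₁)`. -/
lemma exists_measurePreserving_rotation {a₀ a₁ : ℝ} (ha : a₀ ^ 2 + a₁ ^ 2 = 1) :
    ∃ T : EuclideanSpace ℝ (Fin 2) ≃ᵐ ℝ × ℝ, MeasurePreserving T ∧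
      ∀ v, T v = (a₀ * v 0 + a₁ * v 1, a₀ * v 1 - a₁ * v 0) := by
  let R : EuclideanSpace ℝ (Fin 2) ≃ₗᵢ[ℝ] EuclideanSpace ℝ (Fin 2) :=
    LinearIsometry.toLinearIsometryEquiv
      { toFun := fun v => !₂[a₀ * v 0 + a₁ * v 1, a₀ * v 1 - a₁ * v 0]
        map_add' := by
          intro v w
          ext k
          fin_cases k <;> simp <;> ring
        map_smul' := by
          intro r v
          ext k
          fin_cases k <;> simp <;> ring
        norm_map' := by
          intro v
          rw [← sq_eq_sq₀ (norm_nonneg _) (norm_nonneg _), norm_sq_fin_two, norm_sq_fin_two]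
          simp
          linear_combination (v 0 ^ 2 + v 1 ^ 2) * ha } rfl
  refine ⟨(R.toMeasurableEquiv.trans (MeasurableEquiv.toLp 2 (Fin 2 → ℝ)).symm).trans
    MeasurableEquiv.finTwoArrow, ?_, fun v => rfl⟩
  exact ((volume_preserving_finTwoArrow ℝ).comp
    (PiLp.volume_preserving_ofLp (Fin 2))).comp R.measurePreserving

/-- Different cores of the family have distance at least `2`. -/
def SeparatedCores {ι : Type*}
    (φ : ι → EuclideanSpace ℝ (Fin (n + 2)) ≃ᵢ EuclideanSpace ℝ (Fin (n + 2))) : Prop :=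
  Pairwise fun i j => ∀ p q, coreDist (φ i) p = 0 → coreDist (φ j) q = 0 → 2 ≤ dist p q

/-- The sector, in the plane through `φ (combine 0 ξ)` orthogonal to the core of `φ`, over the open
arc of the circle of radius `cutRadius` that is closer to the core of `ψ`. -/
def coreSector (φ ψ : EuclideanSpace ℝ (Fin (n + 2)) ≃ᵢ EuclideanSpace ℝ (Fin (n + 2)))
    (ξ : EuclideanSpace ℝ (Fin n)) : Set (EuclideanSpace ℝ (Fin 2)) :=
  {v | 0 < ‖v‖ ∧ ‖v‖ < cutRadius ∧
    coreDist ψ (φ (combine ((cutRadius / ‖v‖) • v) ξ)) < cutRadius}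

section TwoCores

variable (φ ψ : EuclideanSpace ℝ (Fin (n + 2)) ≃ᵢ EuclideanSpace ℝ (Fin (n + 2)))
  (ξ : EuclideanSpace ℝ (Fin n))

lemma measurableSet_coreSector : MeasurableSet (coreSector φ ψ ξ) := by
  have hm : Measurable fun v : EuclideanSpace ℝ (Fin 2) =>
      coreDist ψ (φ (combine ((cutRadius / ‖v‖) • v) ξ)) := by
    have h1 : Measurable fun v : EuclideanSpace ℝ (Fin 2) => (cutRadius / ‖v‖) • v := by fun_prop
    have h2 : Continuous fun v : EuclideanSpace ℝ (Fin 2) => coreDist ψ (φ (combine v ξ)) :=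
      (continuous_coreDist ψ).comp (φ.continuous.comp
        (continuous_combine.comp (continuous_id.prodMk continuous_const)))
    exact h2.measurable.comp h1
  exact (measurableSet_lt measurable_const measurable_norm).inter
    ((measurableSet_lt measurable_norm measurable_const).inter
      (measurableSet_lt hm measurable_const))

lemma volume_cut_le_coreSector
    (h : ∀ p q, coreDist φ p = 0 → coreDist ψ q = 0 → 2 ≤ dist p q) :
    volume {v : EuclideanSpace ℝ (Fin 2) | ‖v‖ ≤ cutRadius ∧
      coreDist ψ (φ (combine v ξ)) ≤ ‖v‖} ≤
      ENNReal.ofReal (1 - 3 * √3 / (2 * π)) * volume (coreSector φ ψ ξ) := by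
  have hρ := cutRadius_pos
  have hsq := cutRadius_sq
  obtain ⟨t, c, m, a₀, a₁, ht, hc, ha, hnf⟩ :=
    exists_normal_form (φ.trans ψ.symm).toRealAffineIsometryEquiv (fun y hy => by
      obtain ⟨q, hq0, hq⟩ := exists_core_point ψ (φ y)
      have h1 := h (φ y) q (by rw [coreDist, φ.symm_apply_apply, hy, norm_zero]) hq0
      rw [hq] at h1
      simpa [coreDist] using h1) ξ
  have hnf' : ∀ v, coreDist ψ (φ (combine v ξ)) ^ 2 =
      (t - (a₀ * v 0 + a₁ * v 1)) ^ 2 + (c * (a₀ * v 1 - a₁ * v 0) - m) ^ 2 := by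
    intro v
    rw [← hnf v]
    simp [coreDist]
  obtain ⟨T, hT, hTv⟩ := exists_measurePreserving_rotation ha
  have hnorm : ∀ v, ‖v‖ ^ 2 = (T v).1 ^ 2 + (T v).2 ^ 2 := by
    intro v
    rw [hTv, norm_sq_fin_two]
    linear_combination (-(v 0 ^ 2 + v 1 ^ 2)) * ha
  have hdist : ∀ v, coreDist ψ (φ (combine v ξ)) ^ 2 =
      (t - (T v).1) ^ 2 + (c * (T v).2 - m) ^ 2 := by
    intro v; rw [hnf', hTv]
  have hcd0 : ∀ v, 0 ≤ coreDist ψ (φ (combine v ξ)) := fun v => norm_nonneg _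
  calc _ ≤ volume (T ⁻¹' planeCut t c m) := by
        apply measure_mono
        rintro v ⟨h1, h2⟩
        constructor
        · rw [← hnorm, ← hsq]; exact pow_le_pow_left₀ (norm_nonneg _) h1 2
        · rw [← hnorm, ← hdist]; exact pow_le_pow_left₀ (hcd0 v) h2 2
    _ = volume (planeCut t c m) := hT.measure_preimage_equiv _
    _ ≤ _ := volume_planeCut_le_sector ht hc
    _ = ENNReal.ofReal (1 - 3 * √3 / (2 * π)) * volume (T ⁻¹' planeSector t c m) := by
        rw [hT.measure_preimage_equiv]
    _ ≤ _ := by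
        gcongr
        rintro v ⟨r, hr, x, y, hxy, hlt, hv⟩
        have hvn : ‖v‖ = r * cutRadius := by
          rw [← sq_eq_sq₀ (norm_nonneg _) (mul_nonneg hr.1.le hρ.le), hnorm, hv,
            mul_pow r cutRadius, hsq, ← hxy]
          simp only
          ring
        have hr0 := hr.1
        refine ⟨by rw [hvn]; positivity, by rw [hvn]; nlinarith [hr.2], ?_⟩
        have hscale : cutRadius / ‖v‖ = r⁻¹ := by rw [hvn]; field_simp
        rw [hscale, ← sq_lt_sq₀ (hcd0 _) hρ.le, hdist, hsq]
        have hTr : T (r⁻¹ • v) = (x, y) := by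
          have e : T (r⁻¹ • v) = r⁻¹ • T v := by
            rw [hTv, hTv]
            ext <;> simp <;> ring
          rw [e, hv]
          ext <;> simp [hr0.ne']
        rw [hTr]
        exact hlt

end TwoCores

/-- The Dirichlet cell of the `i`-th core, truncated at the distance `cutRadius` from the core.
The strict inequalities make the cells of different cores disjoint. -/
def truncatedCell {ι : Type*}
    (φ : ι → EuclideanSpace ℝ (Fin (n + 2)) ≃ᵢ EuclideanSpace ℝ (Fin (n + 2))) (i : ι) :
    Set (EuclideanSpace ℝ (Fin (n + 2))) :=
  {y | coreDist (φ i) y ≤ cutRadius ∧ ∀ j, j ≠ i → coreDist (φ i) y < coreDist (φ j) y}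

/-- Every slice of a truncated Dirichlet cell by a plane orthogonal to its core has at least the
area of the regular hexagon circumscribed about the unit disk. -/
theorem le_volume_slice {ι : Type*} [Countable ι]
    {φ : ι → EuclideanSpace ℝ (Fin (n + 2)) ≃ᵢ EuclideanSpace ℝ (Fin (n + 2))}
    (hφ : SeparatedCores φ) (i : ι) (ξ : EuclideanSpace ℝ (Fin n)) :
    ENNReal.ofReal √12 ≤
      volume {v : EuclideanSpace ℝ (Fin 2) | φ i (combine v ξ) ∈ truncatedCell φ i} := by
  have hρ := cutRadius_pos
  have hsq := cutRadius_sq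
  set D := {v : EuclideanSpace ℝ (Fin 2) | φ i (combine v ξ) ∈ truncatedCell φ i} with hD
  -- the cut made by the `j`-th core, and the sector that pays for it
  let K : {j // j ≠ i} → Set (EuclideanSpace ℝ (Fin 2)) := fun j =>
    {v | ‖v‖ ≤ cutRadius ∧ coreDist (φ j) (φ i (combine v ξ)) ≤ ‖v‖}
  let S : {j // j ≠ i} → Set (EuclideanSpace ℝ (Fin 2)) := fun j => coreSector (φ i) (φ j) ξ
  have hball : volume (Metric.closedBall (0 : EuclideanSpace ℝ (Fin 2)) cutRadius) =
      ENNReal.ofReal (4 / 3 * π) := by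
    rw [EuclideanSpace.volume_closedBall_fin_two, ← ENNReal.ofReal_pow hρ.le, hsq,
      ENNReal.ofReal_mul (by norm_num)]
  have hcover : Metric.closedBall (0 : EuclideanSpace ℝ (Fin 2)) cutRadius ⊆ D ∪ ⋃ j, K j := by
    intro v hv
    rw [mem_closedBall_zero_iff] at hv
    by_cases h : ∃ j : {j // j ≠ i}, v ∈ K j
    · exact Or.inr (mem_iUnion.2 h)
    · left
      push Not at h
      refine ⟨by rwa [coreDist_apply_combine], fun j hj => ?_⟩
      rw [coreDist_apply_combine]
      by_contra! hle
      exact h ⟨j, hj⟩ ⟨hv, hle⟩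
  have hdisj : Pairwise (Function.onFun Disjoint S) := by
    intro j k hjk
    rw [Function.onFun, Set.disjoint_left]
    rintro v ⟨hv0, -, hj⟩ ⟨-, -, hk⟩
    set z := φ i (combine ((cutRadius / ‖v‖) • v) ξ) with hz
    have hi : coreDist (φ i) z = cutRadius := by
      rw [hz, coreDist_apply_combine, norm_smul, norm_div, norm_norm, Real.norm_of_nonneg hρ.le]
      field_simp
    obtain ⟨p, hp0, hp⟩ := exists_core_point (φ i) z
    obtain ⟨q, hq0, hq⟩ := exists_core_point (φ j) z
    obtain ⟨r, hr0, hr⟩ := exists_core_point (φ k) z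
    exact no_three_separated (hp.trans hi).le (hq ▸ hj) (hr ▸ hk) (hφ j.2.symm p q hp0 hq0)
      (hφ k.2.symm p r hp0 hr0) (hφ (fun h => hjk (Subtype.ext h)) q r hq0 hr0)
  have hS : ∑' j, volume (S j) ≤ ENNReal.ofReal (4 / 3 * π) := by
    rw [← measure_iUnion hdisj fun j => measurableSet_coreSector _ _ _, ← hball]
    refine measure_mono (iUnion_subset fun j v hv => ?_)
    exact mem_closedBall_zero_iff.2 hv.2.1.le
  have h0 := cutShare_nonneg
  have hmain : ENNReal.ofReal (4 / 3 * π) ≤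
      volume D + ENNReal.ofReal ((1 - 3 * √3 / (2 * π)) * (4 / 3 * π)) := by
    calc _ ≤ volume (D ∪ ⋃ j, K j) := hball ▸ measure_mono hcover
      _ ≤ volume D + ∑' j, volume (K j) :=
        (measure_union_le _ _).trans (by gcongr; exact measure_iUnion_le _)
      _ ≤ volume D + ∑' j, ENNReal.ofReal (1 - 3 * √3 / (2 * π)) * volume (S j) := by
        gcongr with j
        exact volume_cut_le_coreSector _ _ _ (hφ j.2.symm)
      _ ≤ _ := by
        rw [ENNReal.tsum_mul_left, ENNReal.ofReal_mul h0]
        gcongr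
  have h12 : √12 = 4 / 3 * π - (1 - 3 * √3 / (2 * π)) * (4 / 3 * π) := by
    have : √12 = 2 * √3 := by
      rw [show (12 : ℝ) = 2 ^ 2 * 3 by norm_num, sqrt_mul (by norm_num), sqrt_sq (by norm_num)]
    rw [this]
    field_simp
    ring
  rw [h12, ENNReal.ofReal_sub _ (by positivity)]
  exact tsub_le_iff_right.2 hmain

/-! ### From slices to densities -/

lemma measurePreserving_apply_combine
    (φ : EuclideanSpace ℝ (Fin (n + 2)) ≃ᵢ EuclideanSpace ℝ (Fin (n + 2))) :
    MeasurePreserving fun p : EuclideanSpace ℝ (Fin 2) × EuclideanSpace ℝ (Fin n) =>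
      φ (combine p.1 p.2) := by
  have hφ : MeasurePreserving φ := by
    have h1 : (φ : EuclideanSpace ℝ (Fin (n + 2)) → EuclideanSpace ℝ (Fin (n + 2))) =
        fun y => φ 0 + φ.toRealAffineIsometryEquiv.linearIsometryEquiv y := by
      funext y
      have := φ.toRealAffineIsometryEquiv.map_vadd 0 y
      simpa [add_comm] using this
    rw [h1]
    exact (measurePreserving_add_left volume (φ 0)).comp
      φ.toRealAffineIsometryEquiv.linearIsometryEquiv.measurePreserving
  exact hφ.comp measurePreserving_combine

/-- If the slices of `X` orthogonal to a core have at most `κ` times the area of those of `Y`, and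
both sets stay near the core, then the volumes within balls compare in the same way, up to a
bounded change of the radius. -/
lemma volume_inter_ball_le
    (φ : EuclideanSpace ℝ (Fin (n + 2)) ≃ᵢ EuclideanSpace ℝ (Fin (n + 2)))
    {X Y : Set (EuclideanSpace ℝ (Fin (n + 2)))} (hX : MeasurableSet X) (hY : MeasurableSet Y)
    {κ : ENNReal} (hκ : κ ≠ ⊤) {M : ℝ} (hXM : ∀ y ∈ X, coreDist φ y ≤ M)
    (hYM : ∀ y ∈ Y, coreDist φ y ≤ M)
    (h : ∀ ξ, volume {v : EuclideanSpace ℝ (Fin 2) | φ (combine v ξ) ∈ X} ≤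
      κ * volume {v : EuclideanSpace ℝ (Fin 2) | φ (combine v ξ) ∈ Y}) (r : ℝ) :
    volume (X ∩ Metric.ball 0 r) ≤ κ * volume (Y ∩ Metric.ball 0 (r + 2 * M)) := by
  have hmp := measurePreserving_apply_combine φ
  have hX' := hX.inter (Metric.isOpen_ball (x := (0 : EuclideanSpace ℝ (Fin (n + 2))))
    (ε := r)).measurableSet
  have hY' := hY.inter (Metric.isOpen_ball (x := (0 : EuclideanSpace ℝ (Fin (n + 2))))
    (ε := r + 2 * M)).measurableSet
  rw [← hmp.measure_preimage hX'.nullMeasurableSet, ← hmp.measure_preimage hY'.nullMeasurableSet,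
    Measure.volume_eq_prod, Measure.prod_apply_symm (hmp.measurable hX'),
    Measure.prod_apply_symm (hmp.measurable hY'), ← lintegral_const_mul' _ _ hκ]
  refine lintegral_mono fun ξ => ?_
  rcases eq_empty_or_nonempty {v : EuclideanSpace ℝ (Fin 2) |
    φ (combine v ξ) ∈ X ∩ Metric.ball 0 r} with he | ⟨w, hwX, hwr⟩
  · exact (measure_mono_null (t := ∅) he.subset measure_empty).trans_le zero_le
  · calc _ ≤ volume {v : EuclideanSpace ℝ (Fin 2) | φ (combine v ξ) ∈ X} :=
          measure_mono fun v hv => hv.1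
      _ ≤ _ := h ξ
      _ ≤ _ := by
        gcongr
        intro v hv
        refine ⟨hv, ?_⟩
        have h1 := hXM _ hwX
        have h2 := hYM _ hv
        rw [coreDist_apply_combine] at h1 h2
        rw [mem_ball_zero_iff, ← dist_zero_right] at hwr ⊢
        have h3 : dist (φ (combine v ξ)) (φ (combine w ξ)) ≤ ‖v‖ + ‖w‖ := by
          rw [φ.dist_eq, dist_combine, dist_eq_norm]; exact norm_sub_le v w
        have h4 := dist_triangle (φ (combine v ξ)) (φ (combine w ξ)) 0
        linarith

lemma tendsto_volume_ball_ratio (M : ℝ) :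
    Filter.Tendsto (fun r : ℝ =>
      volume (Metric.ball (0 : EuclideanSpace ℝ (Fin (n + 2))) (r + M)) /
        volume (Metric.ball (0 : EuclideanSpace ℝ (Fin (n + 2))) r)) Filter.atTop (nhds 1) := by
  have h1 : Filter.Tendsto (fun r : ℝ => ENNReal.ofReal ((1 + M * r⁻¹) ^ (n + 2))) Filter.atTop
      (nhds 1) := by
    have h2 : Filter.Tendsto (fun r : ℝ => (1 + M * r⁻¹) ^ (n + 2)) Filter.atTop (nhds 1) := by
      have := ((tendsto_inv_atTop_zero.const_mul M).const_add 1).pow (n + 2)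
      simpa using this
    simpa using ENNReal.tendsto_ofReal h2
  refine h1.congr' ?_
  filter_upwards [Filter.eventually_gt_atTop 0, Filter.eventually_gt_atTop (-M)] with r hr hr'
  have hu0 : volume (Metric.ball (0 : EuclideanSpace ℝ (Fin (n + 2))) 1) ≠ 0 :=
    (Metric.measure_ball_pos _ _ one_pos).ne'
  have hut : volume (Metric.ball (0 : EuclideanSpace ℝ (Fin (n + 2))) 1) ≠ ⊤ :=
    measure_ball_lt_top.ne
  rw [Measure.addHaar_ball_of_pos _ _ (by linarith : 0 < r + M), Measure.addHaar_ball_of_pos _ _ hr,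
    ENNReal.mul_div_mul_right _ _ hu0 hut, finrank_euclideanSpace_fin,
    ← ENNReal.ofReal_div_of_pos (by positivity), ← div_pow]
  congr 2
  field_simp

section UpperDensity

variable {ι : Type*} {C : ι → Set (EuclideanSpace ℝ (Fin (n + 2)))} {κ : ENNReal} {M : ℝ}

lemma upperDensity_le (hκ : κ ≠ ⊤)
    (h : ∀ r : ℝ, volume ((⋃ i, C i) ∩ Metric.ball 0 r) ≤
      κ * volume (Metric.ball (0 : EuclideanSpace ℝ (Fin (n + 2))) (r + M))) :
    upperDensity C ≤ κ := by
  have ht := ENNReal.Tendsto.const_mul (tendsto_volume_ball_ratio (n := n) M) (Or.inr hκ)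
  rw [mul_one] at ht
  rw [← ht.limsup_eq]
  refine Filter.limsup_le_limsup (Filter.Eventually.of_forall fun r => ?_)
  beta_reduce
  rw [← mul_div_assoc]
  exact ENNReal.div_le_div_right (h r) _

lemma le_upperDensity (hκ : κ ≠ ⊤)
    (h : ∀ r : ℝ, κ * volume (Metric.ball (0 : EuclideanSpace ℝ (Fin (n + 2))) (r + M)) ≤
      volume ((⋃ i, C i) ∩ Metric.ball 0 r)) :
    κ ≤ upperDensity C := by
  have ht := ENNReal.Tendsto.const_mul (tendsto_volume_ball_ratio (n := n) M) (Or.inr hκ)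
  rw [mul_one] at ht
  rw [← ht.limsup_eq]
  refine Filter.limsup_le_limsup (Filter.Eventually.of_forall fun r => ?_)
  beta_reduce
  rw [← mul_div_assoc]
  exact ENNReal.div_le_div_right (h r) _

end UpperDensity

lemma image_stdPolycylinder
    (φ : EuclideanSpace ℝ (Fin (n + 2)) ≃ᵢ EuclideanSpace ℝ (Fin (n + 2))) :
    φ '' stdPolycylinder n = {y | coreDist φ y ≤ 1} := by
  ext y
  rw [mem_ofPred_eq, coreDist, planarPart_eq, ← mem_closedBall_zero_iff]
  constructor
  · rintro ⟨x, hx, rfl⟩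
    rw [φ.symm_apply_apply]
    exact hx
  · intro hy
    exact ⟨φ.symm y, hy, φ.apply_symm_apply y⟩

lemma interior_setOf_coreDist_le
    (φ : EuclideanSpace ℝ (Fin (n + 2)) ≃ᵢ EuclideanSpace ℝ (Fin (n + 2))) :
    interior {y | coreDist φ y ≤ 1} = {y | coreDist φ y < 1} := by
  have hsurj : Function.Surjective (planarPart n) := fun v => ⟨combine v 0, planarPart_combine _ _⟩
  have hopen : IsOpenMap (fun y => planarPart n (φ.symm y)) :=
    ((planarPart n).isOpenMap hsurj).comp φ.symm.toHomeomorph.isOpenMap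
  have hcont : Continuous (fun y => planarPart n (φ.symm y)) :=
    (planarPart n).continuous.comp φ.symm.continuous
  have h1 : {y | coreDist φ y ≤ 1} =
      (fun y => planarPart n (φ.symm y)) ⁻¹' Metric.closedBall 0 1 := by
    ext y; simp [coreDist]
  have h2 : {y | coreDist φ y < 1} = (fun y => planarPart n (φ.symm y)) ⁻¹' Metric.ball 0 1 := by
    ext y; simp [coreDist]
  rw [h1, h2, ← hopen.preimage_interior_eq_interior_preimage hcont,
    interior_closedBall _ one_ne_zero]

/-- If two cores had points at a distance less than `2`, the midpoint would lie in the interior of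
both polycylinders. -/
lemma separatedCores_of_disjoint_interiors {ι : Type*}
    {φ : ι → EuclideanSpace ℝ (Fin (n + 2)) ≃ᵢ EuclideanSpace ℝ (Fin (n + 2))}
    (h : Pairwise fun i j => Disjoint {y | coreDist (φ i) y < 1} {y | coreDist (φ j) y < 1}) :
    SeparatedCores φ := by
  intro i j hij p q hp hq
  by_contra! hlt
  have h1 := coreDist_le_add_dist (φ i) (midpoint ℝ p q) p
  have h2 := coreDist_le_add_dist (φ j) (midpoint ℝ p q) q
  rw [dist_midpoint_left, hp] at h1
  rw [dist_midpoint_right, hq] at h2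
  norm_num at h1 h2
  exact Set.disjoint_left.1 (h hij) (show coreDist (φ i) (midpoint ℝ p q) < 1 by linarith)
    (show coreDist (φ j) (midpoint ℝ p q) < 1 by linarith)

lemma measurableSet_truncatedCell {ι : Type*} [Countable ι]
    (φ : ι → EuclideanSpace ℝ (Fin (n + 2)) ≃ᵢ EuclideanSpace ℝ (Fin (n + 2))) (i : ι) :
    MeasurableSet (truncatedCell φ i) := by
  have hm : ∀ j, Measurable (coreDist (φ j)) := fun j => (continuous_coreDist (φ j)).measurable
  refine (measurableSet_le (hm i) measurable_const).inter ?_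
  change MeasurableSet {y | ∀ j, j ≠ i → coreDist (φ i) y < coreDist (φ j) y}
  simp only [ofPred_forall]
  exact MeasurableSet.iInter fun j => MeasurableSet.iInter fun _ => measurableSet_lt (hm i) (hm j)

lemma volume_slice_polycylinder
    (φ : EuclideanSpace ℝ (Fin (n + 2)) ≃ᵢ EuclideanSpace ℝ (Fin (n + 2)))
    (ξ : EuclideanSpace ℝ (Fin n)) :
    volume {v : EuclideanSpace ℝ (Fin 2) | φ (combine v ξ) ∈ {y | coreDist φ y ≤ 1}} =
      ENNReal.ofReal π := by
  have : {v : EuclideanSpace ℝ (Fin 2) | φ (combine v ξ) ∈ {y | coreDist φ y ≤ 1}} =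
      Metric.closedBall 0 1 := by
    ext v; simp [coreDist_apply_combine]
  rw [this, EuclideanSpace.volume_closedBall_fin_two]
  simp

/-- Polycylinders with disjoint interiors have density at most `π / √12` in their truncated
Dirichlet cells, hence in space. -/
theorem upperDensity_le_of_isPackingBy {ι : Type*}
    {C : ι → Set (EuclideanSpace ℝ (Fin (n + 2)))} (hC : IsPackingBy (stdPolycylinder n) C) :
    upperDensity C ≤ ENNReal.ofReal (π / √12) := by
  have := hC.countable
  choose φ hφ using hC.congruent
  have hCφ : ∀ i, C i = {y | coreDist (φ i) y ≤ 1} := fun i => by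
    rw [hφ, image_stdPolycylinder]
  have hsep : SeparatedCores φ := separatedCores_of_disjoint_interiors fun i j hij => by
    beta_reduce
    rw [← interior_setOf_coreDist_le, ← interior_setOf_coreDist_le, ← hCφ, ← hCφ]
    exact hC.disjoint_interiors hij
  have h12 : 0 < √12 := by positivity
  -- polycylinders and truncated cells lie within the distance `2` of their cores
  refine upperDensity_le (M := 2 * 2) ENNReal.ofReal_ne_top fun r => ?_
  have hcell : ∀ i, volume (C i ∩ Metric.ball 0 r) ≤ ENNReal.ofReal (π / √12) *
      volume (truncatedCell φ i ∩ Metric.ball 0 (r + 2 * 2)) := by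
    intro i
    rw [hCφ i]
    refine volume_inter_ball_le (φ i)
      (measurableSet_le (continuous_coreDist (φ i)).measurable measurable_const)
      (measurableSet_truncatedCell φ i) ENNReal.ofReal_ne_top
      (fun y hy => le_trans hy one_le_two)
      (fun y hy => hy.1.trans (by linarith [cutRadius_lt])) (fun ξ => ?_) r
    rw [volume_slice_polycylinder]
    calc ENNReal.ofReal π = ENNReal.ofReal (π / √12) * ENNReal.ofReal √12 := by
          rw [← ENNReal.ofReal_mul (by positivity), div_mul_cancel₀ _ h12.ne']
      _ ≤ _ := by gcongr; exact le_volume_slice hsep i ξ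
  have hdisj : Pairwise (Function.onFun Disjoint
      fun i => truncatedCell φ i ∩ Metric.ball 0 (r + 2 * 2)) := by
    intro i j hij
    rw [Function.onFun, Set.disjoint_left]
    rintro y ⟨hi, -⟩ ⟨hj, -⟩
    exact lt_asymm (hi.2 j hij.symm) (hj.2 i hij)
  calc volume ((⋃ i, C i) ∩ Metric.ball 0 r)
      ≤ ∑' i, volume (C i ∩ Metric.ball 0 r) := by
        rw [iUnion_inter]; exact measure_iUnion_le _
    _ ≤ ∑' i, ENNReal.ofReal (π / √12) *
          volume (truncatedCell φ i ∩ Metric.ball 0 (r + 2 * 2)) := ENNReal.tsum_le_tsum hcell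
    _ = ENNReal.ofReal (π / √12) *
          volume (⋃ i, truncatedCell φ i ∩ Metric.ball 0 (r + 2 * 2)) := by
        rw [ENNReal.tsum_mul_left, measure_iUnion hdisj fun i =>
          (measurableSet_truncatedCell φ i).inter Metric.isOpen_ball.measurableSet]
    _ ≤ _ := by
        gcongr
        exact iUnion_subset fun i => inter_subset_right

/-! ### The hexagonal packing -/

/-- Center of a disk of the hexagonal packing. -/
noncomputable def hexCenter (p : ℤ × ℤ) : EuclideanSpace ℝ (Fin 2) :=
  !₂[2 * (p.1 : ℝ) + (p.2 : ℝ), √3 * (p.2 : ℝ)]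

/-- The translation that carries the standard polycylinder to `hexPolycylinder n p`. -/
noncomputable def hexTranslation (n : ℕ) (p : ℤ × ℤ) :
    EuclideanSpace ℝ (Fin (n + 2)) ≃ᵢ EuclideanSpace ℝ (Fin (n + 2)) :=
  IsometryEquiv.addLeft (combine (hexCenter p) 0)

lemma planarPart_hexTranslation_symm (p : ℤ × ℤ) (y : EuclideanSpace ℝ (Fin (n + 2))) :
    planarPart n ((hexTranslation n p).symm y) = planarPart n y - hexCenter p := by
  have : (hexTranslation n p).symm y = -combine (hexCenter p) 0 + y := rfl
  rw [this, map_add, map_neg, planarPart_combine]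
  abel

lemma hexPolycylinder_eq (p : ℤ × ℤ) :
    hexPolycylinder n p = {y | coreDist (hexTranslation n p) y ≤ 1} := by
  ext y
  rw [mem_ofPred_eq, coreDist, planarPart_hexTranslation_symm, planarPart_eq, ← dist_eq_norm]
  rfl

lemma two_le_dist_hexCenter {p q : ℤ × ℤ} (hpq : p ≠ q) :
    2 ≤ dist (hexCenter p) (hexCenter q) := by
  have h3 : √3 ^ 2 = 3 := sq_sqrt (by norm_num)
  obtain ⟨a, ha⟩ : ∃ a, a = p.1 - q.1 := ⟨_, rfl⟩
  obtain ⟨b, hb⟩ : ∃ b, b = p.2 - q.2 := ⟨_, rfl⟩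
  have hint : 1 ≤ a ^ 2 + a * b + b ^ 2 := by
    by_contra! hlt
    have hb0 : b = 0 := by
      by_contra hb0
      have : 0 < b ^ 2 := by positivity
      nlinarith [sq_nonneg (2 * a + b)]
    rw [hb0] at hlt
    have ha0 : a = 0 := by
      by_contra ha0
      have : 0 < a ^ 2 := by positivity
      linarith
    exact hpq (Prod.ext (by omega) (by omega))
  have hreal : (1 : ℝ) ≤ (a : ℝ) ^ 2 + a * b + (b : ℝ) ^ 2 := by exact_mod_cast hint
  rw [dist_eq_norm, ← sq_le_sq₀ (by norm_num) (norm_nonneg _), norm_sq_fin_two]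
  have e0 : (hexCenter p - hexCenter q) 0 = 2 * (a : ℝ) + b := by
    simp [hexCenter, ha, hb]; ring
  have e1 : (hexCenter p - hexCenter q) 1 = √3 * (b : ℝ) := by
    simp [hexCenter, hb]; ring
  rw [e0, e1, mul_pow, h3]
  nlinarith

lemma disjoint_hex_interiors : Pairwise fun p q : ℤ × ℤ =>
    Disjoint {y | coreDist (hexTranslation n p) y < 1}
      {y | coreDist (hexTranslation n q) y < 1} := by
  intro p q hpq
  rw [Set.disjoint_left]
  intro y hp hq
  rw [mem_ofPred_eq, coreDist, planarPart_hexTranslation_symm, ← dist_eq_norm] at hp hq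
  have := two_le_dist_hexCenter hpq
  have := dist_triangle_left (hexCenter p) (hexCenter q) (planarPart n y)
  linarith

lemma isPackingBy_hexPolycylinder : IsPackingBy (stdPolycylinder n) (hexPolycylinder n) where
  countable := inferInstance
  congruent p := ⟨hexTranslation n p, by rw [hexPolycylinder_eq, image_stdPolycylinder]⟩
  disjoint_interiors p q hpq := by
    beta_reduce
    rw [hexPolycylinder_eq, hexPolycylinder_eq, interior_setOf_coreDist_le,
      interior_setOf_coreDist_le]
    exact disjoint_hex_interiors hpq

/-- A rectangle with sides `2` and `√3`. Its translates by the hexagonal lattice cover the plane,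
as the bricks of a wall with rows shifted by half a brick. -/
def brick : Set (EuclideanSpace ℝ (Fin 2)) := {v | |v 0| ≤ 1 ∧ |v 1| ≤ √3 / 2}

lemma measurableSet_brick : MeasurableSet brick :=
  (measurableSet_le (f := fun v : EuclideanSpace ℝ (Fin 2) => |v 0|) (by fun_prop)
    measurable_const).inter
    (measurableSet_le (f := fun v : EuclideanSpace ℝ (Fin 2) => |v 1|) (by fun_prop)
      measurable_const)

lemma norm_le_of_mem_brick {v : EuclideanSpace ℝ (Fin 2)} (hv : v ∈ brick) : ‖v‖ ≤ 2 := by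
  have h3 : √3 ^ 2 = 3 := sq_sqrt (by norm_num)
  rw [← sq_le_sq₀ (norm_nonneg _) (by norm_num), norm_sq_fin_two, ← sq_abs (v 0), ← sq_abs (v 1)]
  have h0 := pow_le_pow_left₀ (abs_nonneg _) hv.1 2
  have h1 := pow_le_pow_left₀ (abs_nonneg _) hv.2 2
  rw [div_pow, h3] at h1
  linarith

lemma volume_brick : volume brick = ENNReal.ofReal √12 := by
  have h : brick = (WithLp.ofLp) ⁻¹' (Icc ![-1, -(√3 / 2)] ![1, √3 / 2]) := by
    ext v
    simp [brick, abs_le, Pi.le_def, Fin.forall_fin_two]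
    tauto
  rw [h, (PiLp.volume_preserving_ofLp (Fin 2)).measure_preimage measurableSet_Icc.nullMeasurableSet,
    Real.volume_Icc_pi, Fin.prod_univ_two, ← ENNReal.ofReal_mul (by norm_num)]
  congr 1
  rw [show (12 : ℝ) = 2 ^ 2 * 3 by norm_num, sqrt_mul (by norm_num), sqrt_sq (by norm_num)]
  simp
  ring

lemma exists_sub_hexCenter_mem_brick (v : EuclideanSpace ℝ (Fin 2)) :
    ∃ p, v - hexCenter p ∈ brick := by
  have h3 : 0 < √3 := by positivity
  refine ⟨(round ((v 0 - round (v 1 / √3)) / 2), round (v 1 / √3)), ?_, ?_⟩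
  · have h := abs_sub_round ((v 0 - round (v 1 / √3)) / 2)
    have e : (v - hexCenter (round ((v 0 - round (v 1 / √3)) / 2), round (v 1 / √3))) 0 =
        2 * ((v 0 - round (v 1 / √3)) / 2 - round ((v 0 - round (v 1 / √3)) / 2)) := by
      simp [hexCenter]; ring
    rw [e, abs_mul, abs_of_pos (two_pos : (0 : ℝ) < 2)]
    linarith
  · have h := abs_sub_round (v 1 / √3)
    have e : (v - hexCenter (round ((v 0 - round (v 1 / √3)) / 2), round (v 1 / √3))) 1 =
        √3 * (v 1 / √3 - round (v 1 / √3)) := by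
      simp [hexCenter]; field_simp
    rw [e, abs_mul, abs_of_pos h3]
    nlinarith

/-- Bricks and disks correspond to each other, and the bricks cover space while the open disks are
disjoint. -/
theorem le_upperDensity_hexPolycylinder :
    ENNReal.ofReal (π / √12) ≤ upperDensity (hexPolycylinder n) := by
  have h12 : 0 < √12 := by positivity
  have hπ := pi_pos
  refine le_upperDensity (M := -(2 * 2)) ENNReal.ofReal_ne_top fun r => ?_
  set X : ℤ × ℤ → Set (EuclideanSpace ℝ (Fin (n + 2))) := fun p =>
    {y | planarPart n ((hexTranslation n p).symm y) ∈ brick} with hX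
  set Y : ℤ × ℤ → Set (EuclideanSpace ℝ (Fin (n + 2))) := fun p =>
    {y | coreDist (hexTranslation n p) y < 1} with hY
  have hYm : ∀ p, MeasurableSet (Y p) := fun p =>
    measurableSet_lt (continuous_coreDist _).measurable measurable_const
  have hcell : ∀ p, volume (X p ∩ Metric.ball 0 (r + -(2 * 2))) ≤ ENNReal.ofReal (√12 / π) *
      volume (Y p ∩ Metric.ball 0 r) := by
    intro p
    have h := volume_inter_ball_le (hexTranslation n p) (X := X p) (Y := Y p)
      (κ := ENNReal.ofReal (√12 / π)) (M := 2)
      (((planarPart n).continuous.comp (hexTranslation n p).symm.continuous).measurable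
        measurableSet_brick) (hYm p) ENNReal.ofReal_ne_top
      (fun y hy => norm_le_of_mem_brick hy) (fun y hy => (le_of_lt hy).trans one_le_two)
      (fun ξ => ?_) (r + -(2 * 2))
    · rwa [neg_add_cancel_right] at h
    · have e1 : {v : EuclideanSpace ℝ (Fin 2) | hexTranslation n p (combine v ξ) ∈ X p} = brick := by
        ext v
        simp [hX, planarPart_combine]
      have e2 : {v : EuclideanSpace ℝ (Fin 2) | hexTranslation n p (combine v ξ) ∈ Y p} =
          Metric.ball 0 1 := by
        ext v
        simp [hY, coreDist_apply_combine]
      rw [e1, e2, volume_brick, EuclideanSpace.volume_ball_fin_two, ENNReal.ofReal_one, one_pow,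
        one_mul, ← ENNReal.ofReal_mul (by positivity), div_mul_cancel₀ _ hπ.ne']
  have hball : volume (Metric.ball (0 : EuclideanSpace ℝ (Fin (n + 2))) (r + -(2 * 2))) ≤
      ENNReal.ofReal (√12 / π) * volume ((⋃ p, hexPolycylinder n p) ∩ Metric.ball 0 r) := by
    calc _ ≤ volume (⋃ p, X p ∩ Metric.ball 0 (r + -(2 * 2))) := by
          refine measure_mono fun y hy => ?_
          obtain ⟨p, hp⟩ := exists_sub_hexCenter_mem_brick (planarPart n y)
          refine mem_iUnion.2 ⟨p, ?_, hy⟩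
          rw [hX, mem_ofPred_eq, planarPart_hexTranslation_symm]
          exact hp
      _ ≤ ∑' p, volume (X p ∩ Metric.ball 0 (r + -(2 * 2))) := measure_iUnion_le _
      _ ≤ ∑' p, ENNReal.ofReal (√12 / π) * volume (Y p ∩ Metric.ball 0 r) :=
          ENNReal.tsum_le_tsum hcell
      _ = ENNReal.ofReal (√12 / π) * volume (⋃ p, Y p ∩ Metric.ball 0 r) := by
          rw [ENNReal.tsum_mul_left, measure_iUnion]
          · intro p q hpq
            exact (disjoint_hex_interiors hpq).mono inter_subset_left inter_subset_left
          · exact fun p => (hYm p).inter Metric.isOpen_ball.measurableSet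
      _ ≤ _ := by
          gcongr
          rw [iUnion_inter]
          refine iUnion_mono fun p => inter_subset_inter_left _ fun y hy => ?_
          rw [hexPolycylinder_eq]
          exact le_of_lt (show coreDist (hexTranslation n p) y < 1 from hy)
  calc _ ≤ ENNReal.ofReal (π / √12) * (ENNReal.ofReal (√12 / π) *
        volume ((⋃ p, hexPolycylinder n p) ∩ Metric.ball 0 r)) := by gcongr
    _ = _ := by
        rw [← mul_assoc, ← ENNReal.ofReal_mul (by positivity), div_mul_div_cancel₀ h12.ne',
          div_self hπ.ne', ENNReal.ofReal_one, one_mul]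

end Polycylinders

theorem mainTheorem1 (n : ℕ) :
    (∀ (ι : Type*) (C : ι → Set (EuclideanSpace ℝ (Fin (n + 2)))),
      IsPackingBy (stdPolycylinder n) C →
        upperDensity C ≤ ENNReal.ofReal (Real.pi / √12)) ∧
    upperPackingDensity (stdPolycylinder n) ≤ ENNReal.ofReal (Real.pi / √12) ∧
    IsPackingBy (stdPolycylinder n) (hexPolycylinder n) ∧
    upperDensity (hexPolycylinder n) = ENNReal.ofReal (Real.pi / √12) := by
  refine ⟨fun ι C hC => upperDensity_le_of_isPackingBy hC, sSup_le ?_,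
    isPackingBy_hexPolycylinder, ?_⟩
  · rintro _ ⟨ι, C, hC, rfl⟩
    exact upperDensity_le_of_isPackingBy hC
  · exact (upperDensity_le_of_isPackingBy isPackingBy_hexPolycylinder).antisymm
      le_upperDensity_hexPolycylinder
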